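/- Let $F$ be a field, $a,b\in F$, and let $\mathbb H=\mathbb H(a,b)$ be the quaternion algebra over $F$ with basis $1,i,j,k$ and $i^2=a$, $j^2=b$, $ij=k=-ji$; let $x\mapsto\bar x$ be its conjugation, which negates the coefficients of $i,j,k$. Let $n\ge 1$, let $A\in M(n,\mathbb H)$, and let $A^*=(\overline{a_{ji}})$ be its Hermitian adjoint. For $M=(m_{ij})\in M(n,\mathbb H)$, $\sigma\in S_n$ and an index $x$ whose $\sigma$-cycle has length $l$, put $M_\sigma(x)=m_{x,\sigma(x)}\,m_{\sigma(x),\sigma^2(x)}\cdots m_{\sigma^{l-1}(x),x}$. For an index $i$ let $x_2<\dots<x_r$ be the minimal elements of the cycles of $\sigma$ (fixed points included) that do not contain $i$, so that $\sigma$ has $r$ cycles. The row and column determinants of $M$ are $$\mathrm{rdet}_i M=\sum_{\sigma\in S_n}(-1)^{n-r}M_\sigma(i)\,M_\sigma(x_2)\cdots M_\sigma(x_r),\qquad \mathrm{cdet}_i M=\sum_{\sigma\in S_n}(-1)^{n-r}M_\sigma(x_r)\cdots M_\sigma(x_2)\,M_\sigma(i).$$ Write $M_{.\,j}(c)$ for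 $M$ with its $j$th column replaced by $c$, $M_{i\,.}(c)$ for $M$ with its $i$th row replaced by $c$, and $A^*_{.\,i}$, $A^*_{j\,.}$ for the $i$th column and the $j$th row of $A^*$. **Theorem.** All row and column determinants $\mathrm{rdet}_i$, $\mathrm{cdet}_i$ ($1\le i\le n$) of $A^*A$ and of $AA^*$ are equal to one and the same element of $F$. Denote it by $\mathrm{ddet}\,A=\det(A^*A)=\det(AA^*)$, the double determinant of $A$. The matrix $A$ is invertible if and only if $\mathrm{ddet}\,A\neq 0$. In that case $A^*A$ and $AA^*$ are invertible too, the left inverse $(LA)^{-1}:=(A^*A)^{-1}A^*$ and the right inverse $(RA)^{-1}:=A^*(AA^*)^{-1}$ of $A$ coincide, $A^{-1}=(LA)^{-1}=(RA)^{-1}$, and for all $i,j$ $$\bigl((LA)^{-1}\bigr)_{ij}=\frac{\mathbb L_{ji}}{\mathrm{ddet}\,A},\qquad \bigl((RA)^{-1}\bigr)_{ij}=\frac{\mathbb R_{ji}}{\mathrm{ddet}\,A^*},$$ where $\mathbb L_{ij}=\mathrm{cdet}_j\,(A^*A)_{.\,j}\bigl(A^*_{.\,i}\bigr)$ and $\mathbb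 R_{ij}=\mathrm{rdet}_i\,(AA^*)_{i\,.}\bigl(A^*_{j\,.}\bigr)$. -/

import Mathlib

open scoped Quaternion Matrix

/-- The product `a_{x,σx} a_{σx,σ²x} ⋯ a_{σ⁻¹x,x}` of the entries along the cycle of `σ` through
`x`, started at row `x` and ended at column `x`; it is `a_{x,x}` if `x` is a fixed point. -/
noncomputable def cycleProd {R : Type*} [Ring R] {n : ℕ} (A : Matrix (Fin n) (Fin n) R)
    (σ : Equiv.Perm (Fin n)) (x : Fin n) : R :=
  ((List.range (Function.minimalPeriod σ x)).map
    fun k => A ((σ ^ k) x) ((σ ^ (k + 1)) x)).prod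

/-- The minimal elements of the cycles of `σ` (fixed points included) that do not contain `i`,
in increasing order. -/
def cycleLeaders {n : ℕ} (σ : Equiv.Perm (Fin n)) (i : Fin n) : List (Fin n) :=
  (List.finRange n).filter fun x => ¬ σ.SameCycle i x ∧ ∀ y, σ.SameCycle x y → x ≤ y

/-- The `i`-th row determinant: the cycle through `i` comes first (leftmost), started at `i`; the
other cycles follow from left to right in the increasing order of their minimal elements, each
started at its minimal element. The sign `(-1)^(n-r)`, where `r` is the number of cycles of `σ`,
is the sign of `σ`. -/
noncomputable def rdet {R : Type*} [Ring R] {n : ℕ} (i : Fin n)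
    (A : Matrix (Fin n) (Fin n) R) : R :=
  ∑ σ : Equiv.Perm (Fin n), (Equiv.Perm.sign σ : ℤ) •
    (cycleProd A σ i * ((cycleLeaders σ i).map (cycleProd A σ)).prod)

/-- The `j`-th column determinant: the cycle through `j` comes last (rightmost), ended at column
`j`; the other cycles are placed from right to left in the increasing order of their minimal
elements, each ended at its minimal element. -/
noncomputable def cdet {R : Type*} [Ring R] {n : ℕ} (j : Fin n)
    (A : Matrix (Fin n) (Fin n) R) : R :=
  ∑ τ : Equiv.Perm (Fin n), (Equiv.Perm.sign τ : ℤ) •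
    (((cycleLeaders τ j).reverse.map (cycleProd A τ)).prod * cycleProd A τ j)

/-- The determinant of a Hermitian quaternion matrix, as an element of the base field: the first
row determinant (for the matrices concerned, all row and column determinants are equal and lie
in the base field, which the main statement asserts too). -/
noncomputable def hermDet {F : Type*} [Field F] {a b : F} {n : ℕ} [NeZero n]
    (M : Matrix (Fin n) (Fin n) ℍ[F,a,b]) : F :=
  (rdet 0 M).re

/-- The double determinant `ddet A = det (A* A)`. -/
noncomputable def ddet {F : Type*} [Field F] {a b : F} {n : ℕ} [NeZero n]
    (A : Matrix (Fin n) (Fin n) ℍ[F,a,b]) : F :=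
  hermDet (Aᴴ * A)

/-- The left double cofactor `𝕃_{ij}`: `cdet_j` of `A* A` with its `j`-th column replaced by the
`i`-th column of `A*`. -/
noncomputable def leftDoubleCofactor {F : Type*} [Field F] {a b : F} {n : ℕ}
    (A : Matrix (Fin n) (Fin n) ℍ[F,a,b]) (i j : Fin n) : ℍ[F,a,b] :=
  cdet j ((Aᴴ * A).updateCol j fun k => Aᴴ k i)

/-- The right double cofactor `ℝ_{ij}`: `rdet_i` of `A A*` with its `i`-th row replaced by the
`j`-th row of `A*`. -/
noncomputable def rightDoubleCofactor {F : Type*} [Field F] {a b : F} {n : ℕ}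
    (A : Matrix (Fin n) (Fin n) ℍ[F,a,b]) (i j : Fin n) : ℍ[F,a,b] :=
  rdet i ((A * Aᴴ).updateRow i fun k => Aᴴ j k)

/-- `(LA)⁻¹ = (A* A)⁻¹ A*`. (`Ring.inverse M` is the two-sided inverse of an invertible `M`.) -/
noncomputable def leftInv {F : Type*} [Field F] {a b : F} {n : ℕ}
    (A : Matrix (Fin n) (Fin n) ℍ[F,a,b]) : Matrix (Fin n) (Fin n) ℍ[F,a,b] :=
  Ring.inverse (Aᴴ * A) * Aᴴ

/-- `(RA)⁻¹ = A* (A A*)⁻¹`. -/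
noncomputable def rightInv {F : Type*} [Field F] {a b : F} {n : ℕ}
    (A : Matrix (Fin n) (Fin n) ℍ[F,a,b]) : Matrix (Fin n) (Fin n) ℍ[F,a,b] :=
  Aᴴ * Ring.inverse (A * Aᴴ)

/-! Work first over a domain of characteristic zero. For a Hermitian `M`, reversing a cycle of `σ`
conjugates the product along it, so the products along a cycle may be replaced by their real parts
in the sum of `cdet j M`. What remains is `mooreDet M`. It does not depend on `j`, because the real
part of a product is invariant under rotation of its factors. For the column replaced by another
one, pairing `σ` with `swap j l * σ` and then reversing the cycle through `l` makes everything
cancel (`cdet_eq_zero_of_column_eq`). Hence `cdetAdjugate M * M = mooreDet M • 1`.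

Multiplicativity comes from calculus. Jacobi's formula `derivation_mooreDet` shows that, for
constant Hermitian `M`, the determinants of `Bᴴ * M * B` and `B * Bᴴ` have the same logarithmic
derivative, formally `2 Re tr(B⁻¹ dB)`. Integrating along the segment from `1` to `B` gives
`mooreDet (Bᴴ * M * B) = mooreDet M * mooreDet (B * Bᴴ)`. The case `M = 1` identifies the
determinants of `BᴴB` and `BBᴴ`; the case `M = AᴴA` makes `ddet` multiplicative.

The pairings only show that twice a sum vanishes, which says nothing in characteristic two. The
identities for `AᴴA` are however polynomial with integer coefficients, so they are proved for a lift
of `A` over `MvPolynomial F ℤ` and specialized. Multiplicativity then gives `ddet A ≠ 0` for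
invertible `A`; the adjugate gives the converse and Cramer's rule, and conjugation turns the column
statements into row statements. -/

namespace Equiv.Perm

/-! ### Orbits and periods of permutations. -/

variable {α : Type*}

theorem sameCycle_iff_exists_nat_pow [Finite α] {σ : Perm α} {x y : α} :
    σ.SameCycle x y ↔ ∃ k : ℕ, (σ ^ k) x = y :=
  ⟨fun h => h.exists_nat_pow_eq, fun ⟨k, hk⟩ => ⟨k, by simpa using hk⟩⟩

theorem pow_succ_apply (σ : Perm α) (k : ℕ) (x : α) : (σ ^ (k + 1)) x = σ ((σ ^ k) x) := by
  rw [pow_succ', mul_apply]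

theorem minimalPeriod_pos [Finite α] (σ : Perm α) (x : α) : 0 < Function.minimalPeriod σ x :=
  Function.minimalPeriod_pos_of_mem_periodicPts (σ.injective.mem_periodicPts x)

theorem pow_minimalPeriod (σ : Perm α) (x : α) : (σ ^ Function.minimalPeriod σ x) x = x := by
  rw [← iterate_eq_pow]
  exact Function.iterate_minimalPeriod

theorem pow_add_minimalPeriod (σ : Perm α) (x : α) (k : ℕ) :
    (σ ^ (k + Function.minimalPeriod σ x)) x = (σ ^ k) x := by
  rw [pow_add, mul_apply, pow_minimalPeriod]

theorem pow_apply_inj_of_lt {σ : Perm α} {x : α} {k m : ℕ}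
    (hk : k < Function.minimalPeriod σ x) (hm : m < Function.minimalPeriod σ x)
    (h : (σ ^ k) x = (σ ^ m) x) : k = m := by
  rw [← iterate_eq_pow, ← iterate_eq_pow] at h
  exact (Function.iterate_eq_iterate_iff_of_lt_minimalPeriod hk hm).1 h

theorem minimalPeriod_eq_of_pow_iff {σ τ : Perm α} {x y : α}
    (h : ∀ k : ℕ, (σ ^ k) x = x ↔ (τ ^ k) y = y) :
    Function.minimalPeriod σ x = Function.minimalPeriod τ y := by
  rw [Function.minimalPeriod_eq_minimalPeriod_iff]
  intro k
  simpa [Function.IsPeriodicPt, Function.IsFixedPt, iterate_eq_pow] using h k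

/-- The period of `x` is `p` if the orbit returns to `x` after `p > 0` steps, and not before. -/
theorem minimalPeriod_eq_of_forall_lt {σ : Perm α} {x : α} {p : ℕ} (hp : 0 < p)
    (h : (σ ^ p) x = x) (hlt : ∀ k, 0 < k → k < p → (σ ^ k) x ≠ x) :
    Function.minimalPeriod σ x = p := by
  have hper : Function.IsPeriodicPt σ p x := by
    simpa [Function.IsPeriodicPt, Function.IsFixedPt, iterate_eq_pow] using h
  refine le_antisymm (hper.minimalPeriod_le hp) ?_
  by_contra! hlt'
  exact hlt _ (hper.minimalPeriod_pos hp) hlt' (pow_minimalPeriod σ x)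

theorem pow_apply_eq_of_agree {σ τ : Perm α} {x : α}
    (h : ∀ y, σ.SameCycle x y → τ y = σ y) (k : ℕ) : (τ ^ k) x = (σ ^ k) x := by
  induction k with
  | zero => rfl
  | succ k ih =>
    rw [pow_succ_apply, pow_succ_apply, ih]
    exact h _ (sameCycle_pow_right.2 (SameCycle.refl _ _))

theorem sameCycle_iff_of_agree [Finite α] {σ τ : Perm α} {x : α}
    (h : ∀ y, σ.SameCycle x y → τ y = σ y) (y : α) : τ.SameCycle x y ↔ σ.SameCycle x y := by
  simp only [sameCycle_iff_exists_nat_pow, pow_apply_eq_of_agree h]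

theorem minimalPeriod_eq_of_agree {σ τ : Perm α} {x : α}
    (h : ∀ y, σ.SameCycle x y → τ y = σ y) :
    Function.minimalPeriod τ x = Function.minimalPeriod σ x :=
  minimalPeriod_eq_of_pow_iff fun k => by rw [pow_apply_eq_of_agree h]

theorem SameCycle.minimalPeriod_eq [Finite α] {σ : Perm α} {x y : α} (h : σ.SameCycle x y) :
    Function.minimalPeriod σ y = Function.minimalPeriod σ x := by
  obtain ⟨k, rfl⟩ := sameCycle_iff_exists_nat_pow.1 h
  rw [← iterate_eq_pow]
  exact Function.minimalPeriod_apply_iterate (σ.injective.mem_periodicPts x) k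

theorem minimalPeriod_inv (σ : Perm α) (x : α) :
    Function.minimalPeriod (σ⁻¹ : Perm α) x = Function.minimalPeriod σ x :=
  minimalPeriod_eq_of_pow_iff fun k => by
    rw [inv_pow, inv_eq_iff_eq]
    exact eq_comm

/-! ### Reversing one cycle. -/

section Reverse

variable [Fintype α] [DecidableEq α]

/-- `σ` with its cycle through `x` reversed. -/
def reverseCycle (σ : Perm α) (x : α) : Perm α := σ * (σ.cycleOf x)⁻¹ ^ 2

theorem reverseCycle_apply_of_sameCycle {σ : Perm α} {x y : α} (h : σ.SameCycle x y) :
    σ.reverseCycle x y = σ⁻¹ y := by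
  have h1 : (σ.cycleOf x)⁻¹ y = σ⁻¹ y := by
    rw [cycleOf_inv, cycleOf_apply, if_pos (sameCycle_inv.2 h)]
  have h2 : (σ.cycleOf x)⁻¹ (σ⁻¹ y) = σ⁻¹ (σ⁻¹ y) := by
    rw [cycleOf_inv, cycleOf_apply, if_pos]
    rw [sameCycle_apply_right]
    exact sameCycle_inv.2 h
  rw [reverseCycle, mul_apply, pow_two, mul_apply, h1, h2]
  exact σ.apply_symm_apply _

theorem reverseCycle_apply_of_not_sameCycle {σ : Perm α} {x y : α} (h : ¬ σ.SameCycle x y) :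
    σ.reverseCycle x y = σ y := by
  have h1 : (σ.cycleOf x)⁻¹ y = y := by
    rw [cycleOf_inv, cycleOf_apply, if_neg (fun h' => h (sameCycle_inv.1 h'))]
  rw [reverseCycle, mul_apply, pow_two, mul_apply, h1, h1]

-- The reversed permutation differs from `σ` by a square.
@[simp]
theorem sign_reverseCycle (σ : Perm α) (x : α) : sign (σ.reverseCycle x) = sign σ := by
  rw [reverseCycle, map_mul, map_pow, Int.units_sq, mul_one]

theorem reverseCycle_agree {σ : Perm α} {x y : α} (h : ¬ σ.SameCycle x y) :
    ∀ z, σ.SameCycle y z → σ.reverseCycle x z = σ z := fun _ hz =>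
  reverseCycle_apply_of_not_sameCycle fun hx => h (hx.trans hz.symm)

theorem reverseCycle_agree_inv {σ : Perm α} {x y : α} (h : σ.SameCycle x y) :
    ∀ z, σ⁻¹.SameCycle y z → σ.reverseCycle x z = σ⁻¹ z := fun _ hz =>
  reverseCycle_apply_of_sameCycle (h.trans (sameCycle_inv.1 hz))

theorem sameCycle_reverseCycle {σ : Perm α} {x y z : α} :
    (σ.reverseCycle x).SameCycle y z ↔ σ.SameCycle y z := by
  by_cases h : σ.SameCycle x y
  · rw [sameCycle_iff_of_agree (reverseCycle_agree_inv h), sameCycle_inv]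
  · exact sameCycle_iff_of_agree (reverseCycle_agree h) z

@[simp]
theorem reverseCycle_reverseCycle (σ : Perm α) (x : α) :
    (σ.reverseCycle x).reverseCycle x = σ := by
  ext1 y
  by_cases h : σ.SameCycle x y
  · rw [reverseCycle_apply_of_sameCycle (sameCycle_reverseCycle.2 h), inv_eq_iff_eq,
      reverseCycle_apply_of_sameCycle (sameCycle_apply_right.2 h)]
    exact (σ.symm_apply_apply y).symm
  · rw [reverseCycle_apply_of_not_sameCycle (fun h' => h (sameCycle_reverseCycle.1 h')),
      reverseCycle_apply_of_not_sameCycle h]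

/-- Reversing the cycle through `x`, as a permutation of the permutations. -/
def reverseCycleEquiv (x : α) : Perm (Perm α) :=
  ⟨fun σ => σ.reverseCycle x, fun σ => σ.reverseCycle x, fun σ => by simp, fun σ => by simp⟩

@[simp]
theorem reverseCycleEquiv_apply (σ : Perm α) (x : α) :
    reverseCycleEquiv x σ = σ.reverseCycle x := rfl

end Reverse

/-! ### Splitting and merging cycles by a transposition. -/

section Merge

variable [Fintype α] [DecidableEq α] {σ : Perm α} {j l : α}

/-- Multiplying by `swap j l` splits a cycle that contains both `j` and `l`. -/
theorem SameCycle.not_sameCycle_swap_mul (hjl : j ≠ l) (h : σ.SameCycle j l) :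
    ¬ (swap j l * σ).SameCycle j l := by
  classical
  obtain ⟨k, hk⟩ := sameCycle_iff_exists_nat_pow.1 h
  have hex : ∃ k, (σ ^ k) j = l := ⟨k, hk⟩
  -- The first time at which the orbit of `j` meets `l`. The transposition sends the orbit back to
  -- `j` at that moment, so `l` is never reached.
  set m := Nat.find hex with hm
  have hml : (σ ^ m) j = l := Nat.find_spec hex
  have hmin : ∀ i < m, (σ ^ i) j ≠ l := fun i hi => Nat.find_min hex hi
  have hm0 : 0 < m := by
    rcases Nat.eq_zero_or_pos m with h0 | h0
    · rw [h0] at hml; exact absurd hml hjl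
    · exact h0
  have hinv : ∀ k : ℕ, ∃ i < m, ((swap j l * σ) ^ k) j = (σ ^ i) j := by
    intro k
    induction k with
    | zero => exact ⟨0, hm0, by simp⟩
    | succ k ih =>
      obtain ⟨i, hi, hik⟩ := ih
      rw [pow_succ_apply, hik, mul_apply, ← pow_succ_apply]
      by_cases him : i + 1 = m
      · exact ⟨0, hm0, by rw [him, hml, swap_apply_right]; simp⟩
      · by_cases hj : (σ ^ (i + 1)) j = j
        · exfalso
          -- A return to `j` after `i + 1 < m` steps would confine the orbit to its first `i + 1`
          -- points, and `l` would be met before time `m`.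
          have : ∀ q : ℕ, ∃ r < i + 1, (σ ^ q) j = (σ ^ r) j := by
            intro q
            refine ⟨q % (i + 1), Nat.mod_lt _ (Nat.succ_pos _), ?_⟩
            have hq : (σ ^ ((i + 1) * (q / (i + 1)))) j = j := by
              rw [pow_mul]
              exact pow_apply_eq_self_of_apply_eq_self hj _
            conv_lhs => rw [← Nat.mod_add_div q (i + 1), pow_add, mul_apply, hq]
          obtain ⟨r, hr, hr'⟩ := this m
          exact hmin r (by omega) (hr' ▸ hml)
        · exact ⟨i + 1, by omega, swap_apply_of_ne_of_ne hj (hmin _ (by omega))⟩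
  intro hs
  obtain ⟨k, hk⟩ := sameCycle_iff_exists_nat_pow.1 hs
  obtain ⟨i, hi, hik⟩ := hinv k
  exact hmin i hi (hik ▸ hk)

/-- Until the orbit of `j` closes up it meets neither `j` nor `l`, so the transposition is not felt.
On closing, it is redirected to `l`; by symmetry the orbit of `l` then leads back to `j`. -/
theorem swap_mul_pow_apply_left {k : ℕ} (h : ¬ σ.SameCycle j l)
    (hk : k < Function.minimalPeriod σ j) :
    ((swap j l * σ) ^ k) j = (σ ^ k) j := by
  induction k with
  | zero => rfl
  | succ k ih =>
    rw [pow_succ_apply, ih (by omega), mul_apply, ← pow_succ_apply]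
    refine swap_apply_of_ne_of_ne ?_ ?_
    · intro h'
      have := pow_apply_inj_of_lt hk (minimalPeriod_pos σ j) (by simpa using h')
      omega
    · exact fun h' => h (sameCycle_iff_exists_nat_pow.2 ⟨_, h'⟩)

theorem swap_mul_pow_minimalPeriod_apply_left (h : ¬ σ.SameCycle j l) :
    ((swap j l * σ) ^ Function.minimalPeriod σ j) j = l := by
  obtain ⟨p, hp⟩ : ∃ p, Function.minimalPeriod σ j = p + 1 :=
    ⟨_, (Nat.succ_pred_eq_of_pos (minimalPeriod_pos σ j)).symm⟩
  rw [hp, pow_succ_apply, swap_mul_pow_apply_left h (by omega), mul_apply, ← pow_succ_apply, ← hp,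
    pow_minimalPeriod, swap_apply_left]

theorem swap_mul_pow_add_apply {k : ℕ} (h : ¬ σ.SameCycle j l)
    (hk : k < Function.minimalPeriod σ l) :
    ((swap j l * σ) ^ (k + Function.minimalPeriod σ j)) j = (σ ^ k) l := by
  rw [pow_add, mul_apply, swap_mul_pow_minimalPeriod_apply_left h, swap_comm]
  exact swap_mul_pow_apply_left (fun h' => h h'.symm) hk

theorem swap_mul_pow_add_minimalPeriod_apply (h : ¬ σ.SameCycle j l) :
    ((swap j l * σ) ^ (Function.minimalPeriod σ l + Function.minimalPeriod σ j)) j = j := by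
  rw [pow_add, mul_apply, swap_mul_pow_minimalPeriod_apply_left h, swap_comm]
  exact swap_mul_pow_minimalPeriod_apply_left (fun h' => h h'.symm)

theorem minimalPeriod_swap_mul (h : ¬ σ.SameCycle j l) :
    Function.minimalPeriod (swap j l * σ : Perm α) j =
      Function.minimalPeriod σ l + Function.minimalPeriod σ j := by
  have hj := minimalPeriod_pos σ j
  refine minimalPeriod_eq_of_forall_lt (by omega) (swap_mul_pow_add_minimalPeriod_apply h) ?_
  intro k hk0 hk hkj
  by_cases hkp : k < Function.minimalPeriod σ j
  · rw [swap_mul_pow_apply_left h hkp] at hkj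
    have := pow_apply_inj_of_lt hkp hj (by simpa using hkj)
    omega
  · obtain ⟨q, rfl⟩ := Nat.exists_eq_add_of_le' (not_lt.1 hkp)
    rw [swap_mul_pow_add_apply h (by omega)] at hkj
    exact h (sameCycle_iff_exists_nat_pow.2 ⟨q, hkj⟩).symm

theorem sameCycle_swap_mul_left (h : ¬ σ.SameCycle j l) (y : α) :
    (swap j l * σ).SameCycle j y ↔ σ.SameCycle j y ∨ σ.SameCycle l y := by
  have hj := minimalPeriod_pos σ j
  have hl := minimalPeriod_pos σ l
  constructor
  · intro hs
    obtain ⟨k, rfl⟩ := sameCycle_iff_exists_nat_pow.1 hs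
    induction k with
    | zero => exact Or.inl (SameCycle.refl _ _)
    | succ k ih =>
      have := ih (sameCycle_pow_right.2 (SameCycle.refl _ _))
      rw [pow_succ_apply, mul_apply]
      rw [swap_apply_def]
      split_ifs
      · exact Or.inr (SameCycle.refl _ _)
      · exact Or.inl (SameCycle.refl _ _)
      · simpa only [sameCycle_apply_right] using this
  · rintro (hs | hs)
    · obtain ⟨k, rfl⟩ := sameCycle_iff_exists_nat_pow.1 hs
      refine sameCycle_iff_exists_nat_pow.2 ⟨k % Function.minimalPeriod σ j, ?_⟩
      rw [swap_mul_pow_apply_left h (Nat.mod_lt _ hj), ← iterate_eq_pow, ← iterate_eq_pow,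
        Function.iterate_mod_minimalPeriod_eq]
    · obtain ⟨k, rfl⟩ := sameCycle_iff_exists_nat_pow.1 hs
      refine sameCycle_iff_exists_nat_pow.2
        ⟨k % Function.minimalPeriod σ l + Function.minimalPeriod σ j, ?_⟩
      rw [swap_mul_pow_add_apply h (Nat.mod_lt _ hl), ← iterate_eq_pow, ← iterate_eq_pow,
        Function.iterate_mod_minimalPeriod_eq]

theorem swap_mul_agree {α : Type*} [DecidableEq α] {σ : Perm α} {j l x : α}
    (hj : ¬ σ.SameCycle j x) (hl : ¬ σ.SameCycle l x) :
    ∀ y, σ.SameCycle x y → (swap j l * σ) y = σ y := fun y hy => by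
  rw [mul_apply]
  refine swap_apply_of_ne_of_ne ?_ ?_
  · exact fun h => hj (h ▸ (sameCycle_apply_right.2 hy).symm)
  · exact fun h => hl (h ▸ (sameCycle_apply_right.2 hy).symm)

theorem sameCycle_swap_mul_iff (hjl : j ≠ l) :
    (swap j l * σ).SameCycle j l ↔ ¬ σ.SameCycle j l :=
  ⟨fun h h' => h'.not_sameCycle_swap_mul hjl h, fun h =>
    (sameCycle_swap_mul_left h l).2 (Or.inr (SameCycle.refl _ _))⟩

end Merge

end Equiv.Perm

/-! ### Products along cycles. -/

section CycleProd

variable {R : Type*} [Ring R] {n : ℕ}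

theorem star_prod_map_range [StarRing R] (f : ℕ → R) (p : ℕ) :
    star ((List.range p).map f).prod = ((List.range p).map fun k => star (f (p - 1 - k))).prod := by
  induction p with
  | zero => simp
  | succ p ih =>
    rw [List.prod_range_succ, star_mul, ih, List.prod_range_succ']
    congr 2
    refine List.map_congr_left fun k _ => ?_
    congr 2
    omega

theorem cycleProd_congr {M N : Matrix (Fin n) (Fin n) R} {σ τ : Equiv.Perm (Fin n)} {x y : Fin n}
    (hp : Function.minimalPeriod σ x = Function.minimalPeriod τ y)
    (h : ∀ k < Function.minimalPeriod τ y,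
      M ((σ ^ k) x) ((σ ^ (k + 1)) x) = N ((τ ^ k) y) ((τ ^ (k + 1)) y)) :
    cycleProd M σ x = cycleProd N τ y := by
  unfold cycleProd
  rw [hp]
  exact congrArg List.prod (List.map_congr_left fun k hk => h k (List.mem_range.1 hk))

theorem cycleProd_congr_matrix {M N : Matrix (Fin n) (Fin n) R} {σ : Equiv.Perm (Fin n)} {x : Fin n}
    (h : ∀ y, σ.SameCycle x y → M y (σ y) = N y (σ y)) :
    cycleProd M σ x = cycleProd N σ x :=
  cycleProd_congr rfl fun k _ => by
    rw [Equiv.Perm.pow_succ_apply]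
    exact h _ (Equiv.Perm.sameCycle_pow_right.2 (Equiv.Perm.SameCycle.refl _ _))

theorem cycleProd_of_agree (M : Matrix (Fin n) (Fin n) R) {σ τ : Equiv.Perm (Fin n)} {x : Fin n}
    (h : ∀ y, σ.SameCycle x y → τ y = σ y) : cycleProd M τ x = cycleProd M σ x :=
  cycleProd_congr (Equiv.Perm.minimalPeriod_eq_of_agree h) fun k _ => by
    rw [Equiv.Perm.pow_apply_eq_of_agree h, Equiv.Perm.pow_apply_eq_of_agree h]

theorem map_cycleProd {S : Type*} [Ring S] (f : R →+* S) (M : Matrix (Fin n) (Fin n) R)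
    (σ : Equiv.Perm (Fin n)) (x : Fin n) :
    f (cycleProd M σ x) = cycleProd (M.map f) σ x := by
  simp [cycleProd, map_list_prod, Function.comp_def]

theorem star_cycleProd [StarRing R] (M : Matrix (Fin n) (Fin n) R) (σ : Equiv.Perm (Fin n))
    (x : Fin n) : star (cycleProd M σ x) = cycleProd Mᴴ σ⁻¹ x := by
  unfold cycleProd
  rw [star_prod_map_range, Equiv.Perm.minimalPeriod_inv]
  refine congrArg List.prod (List.map_congr_left fun k hk => ?_)
  have hk := List.mem_range.1 hk
  set p := Function.minimalPeriod σ x with hp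
  have key : ∀ m ≤ p, ((σ⁻¹) ^ m) x = (σ ^ (p - m)) x := fun m hm => by
    rw [inv_pow, Equiv.Perm.inv_eq_iff_eq, ← Equiv.Perm.mul_apply, ← pow_add,
      Nat.add_sub_cancel' hm, Equiv.Perm.pow_minimalPeriod]
  rw [Matrix.conjTranspose_apply, key k hk.le, key (k + 1) hk]
  congr 3 <;> congr 1 <;> omega

/-- Starting one step later moves the first factor to the end. -/
theorem cycleProd_apply_eq (M : Matrix (Fin n) (Fin n) R) (σ : Equiv.Perm (Fin n)) (x : Fin n) :
    ∃ u, cycleProd M σ x = M x (σ x) * u ∧ cycleProd M σ (σ x) = u * M x (σ x) := by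
  obtain ⟨p, hp⟩ : ∃ p, Function.minimalPeriod σ x = p + 1 :=
    ⟨_, (Nat.succ_pred_eq_of_pos (Equiv.Perm.minimalPeriod_pos σ x)).symm⟩
  refine ⟨((List.range p).map fun k => M ((σ ^ (k + 1)) x) ((σ ^ (k + 2)) x)).prod, ?_, ?_⟩
  · rw [cycleProd, hp, List.prod_range_succ']
    simp
  · have h1 : Function.minimalPeriod σ (σ x) = p + 1 :=
      (Equiv.Perm.SameCycle.minimalPeriod_eq
        (Equiv.Perm.sameCycle_apply_right.2 (Equiv.Perm.SameCycle.refl σ x))).trans hp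
    have h2 : ∀ k : ℕ, (σ ^ k) (σ x) = (σ ^ (k + 1)) x := fun k => by
      rw [pow_succ, Equiv.Perm.mul_apply]
    have h3 : (σ ^ (p + 1)) x = x := hp ▸ Equiv.Perm.pow_minimalPeriod σ x
    rw [cycleProd, h1, List.prod_range_succ]
    simp only [h2, h3, Equiv.Perm.pow_succ_apply _ (p + 1)]

theorem cycleProd_reverseCycle_of_not_sameCycle (M : Matrix (Fin n) (Fin n) R)
    {σ : Equiv.Perm (Fin n)} {x y : Fin n} (h : ¬ σ.SameCycle x y) :
    cycleProd M (σ.reverseCycle x) y = cycleProd M σ y :=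
  cycleProd_of_agree M (Equiv.Perm.reverseCycle_agree h)

/-- Conjugation reverses the factors and, by Hermitian symmetry, transposes each entry, so it runs
through the cycle backwards. Symmetry is required on this cycle only, so that row and column `j` may
be arbitrary when the cycle avoids `j`. -/
theorem cycleProd_reverseCycle_self [StarRing R] {M : Matrix (Fin n) (Fin n) R}
    {σ : Equiv.Perm (Fin n)} {x : Fin n}
    (hM : ∀ y z, σ.SameCycle x y → σ.SameCycle x z → M y z = star (M z y)) :
    cycleProd M (σ.reverseCycle x) x = star (cycleProd M σ x) := by
  rw [star_cycleProd, cycleProd_of_agree M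
    (Equiv.Perm.reverseCycle_agree_inv (Equiv.Perm.SameCycle.refl σ x))]
  refine cycleProd_congr_matrix fun y hy => ?_
  rw [Equiv.Perm.sameCycle_inv] at hy
  rw [Matrix.conjTranspose_apply]
  refine hM _ _ hy ?_
  rw [← Equiv.Perm.sameCycle_inv, Equiv.Perm.sameCycle_apply_right, Equiv.Perm.sameCycle_inv]
  exact hy

/-- If the columns `j` and `l` are equal, merging the cycles through `j` and `l` multiplies the
products of the entries along them. -/
theorem cycleProd_swap_mul {M : Matrix (Fin n) (Fin n) R} {σ : Equiv.Perm (Fin n)} {j l : Fin n}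
    (h : ¬ σ.SameCycle j l) (hM : ∀ x, M x j = M x l) :
    cycleProd M (Equiv.swap j l * σ) j = cycleProd M σ j * cycleProd M σ l := by
  have hsw : ∀ x y, M x (Equiv.swap j l y) = M x y := fun x y => by
    rw [Equiv.swap_apply_def]
    split_ifs with h1 h2
    · rw [h1, hM]
    · rw [h2, hM]
    · rfl
  unfold cycleProd
  rw [Equiv.Perm.minimalPeriod_swap_mul h, add_comm, List.range_add, List.map_append,
    List.prod_append, List.map_map]
  congr 1
  · refine congrArg List.prod (List.map_congr_left fun k hk => ?_)
    have hk := List.mem_range.1 hk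
    rw [Equiv.Perm.pow_succ_apply, Equiv.Perm.swap_mul_pow_apply_left h hk, Equiv.Perm.mul_apply,
      hsw, Equiv.Perm.pow_succ_apply]
  · refine congrArg List.prod (List.map_congr_left fun k hk => ?_)
    have hk := List.mem_range.1 hk
    rw [Function.comp_apply, Equiv.Perm.pow_succ_apply, add_comm,
      Equiv.Perm.swap_mul_pow_add_apply h hk, Equiv.Perm.mul_apply, hsw, Equiv.Perm.pow_succ_apply]

theorem cycleProd_updateCol_of_not_sameCycle (M : Matrix (Fin n) (Fin n) R) (c : Fin n → R)
    {σ : Equiv.Perm (Fin n)} {j x : Fin n} (h : ¬ σ.SameCycle j x) :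
    cycleProd (M.updateCol j c) σ x = cycleProd M σ x :=
  cycleProd_congr_matrix fun y hy => by
    rw [Matrix.updateCol_apply, if_neg]
    exact fun h' => h (h' ▸ (Equiv.Perm.sameCycle_apply_right.2 hy).symm)

/-- The product of all but the last of the entries along the cycle of `σ` through `x`. -/
noncomputable def cyclePrefix (M : Matrix (Fin n) (Fin n) R) (σ : Equiv.Perm (Fin n))
    (x : Fin n) : R :=
  ((List.range (Function.minimalPeriod σ x - 1)).map
    fun k => M ((σ ^ k) x) ((σ ^ (k + 1)) x)).prod

/-- Column `x` enters only through the last factor; this makes `cdet x` linear in that column, with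
coefficients on the left. -/
theorem cycleProd_eq_cyclePrefix_mul (M : Matrix (Fin n) (Fin n) R) (σ : Equiv.Perm (Fin n))
    (x : Fin n) : cycleProd M σ x = cyclePrefix M σ x * M (σ⁻¹ x) x := by
  obtain ⟨p, hp⟩ : ∃ p, Function.minimalPeriod σ x = p + 1 :=
    ⟨_, (Nat.succ_pred_eq_of_pos (Equiv.Perm.minimalPeriod_pos σ x)).symm⟩
  have h1 : (σ ^ (p + 1)) x = x := hp ▸ Equiv.Perm.pow_minimalPeriod σ x
  have h2 : (σ ^ p) x = σ⁻¹ x := by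
    rw [Equiv.Perm.eq_inv_iff_eq, ← Equiv.Perm.pow_succ_apply, h1]
  rw [cycleProd, cyclePrefix, hp, List.prod_range_succ, h1, h2, Nat.add_sub_cancel]

theorem cyclePrefix_updateCol (M : Matrix (Fin n) (Fin n) R) (c : Fin n → R)
    (σ : Equiv.Perm (Fin n)) (j : Fin n) :
    cyclePrefix (M.updateCol j c) σ j = cyclePrefix M σ j := by
  refine congrArg List.prod (List.map_congr_left fun k hk => ?_)
  have hk := List.mem_range.1 hk
  rw [Matrix.updateCol_apply, if_neg]
  intro h
  have := Equiv.Perm.pow_apply_inj_of_lt (by omega) (Equiv.Perm.minimalPeriod_pos σ j)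
    (k := k + 1) (m := 0) (by simpa using h)
  omega

theorem cycleProd_updateCol_self (M : Matrix (Fin n) (Fin n) R) (c : Fin n → R)
    (σ : Equiv.Perm (Fin n)) (j : Fin n) :
    cycleProd (M.updateCol j c) σ j = cyclePrefix M σ j * c (σ⁻¹ j) := by
  rw [cycleProd_eq_cyclePrefix_mul, cyclePrefix_updateCol, Matrix.updateCol_self]

end CycleProd

/-! ### Minimal elements of cycles. -/

section CycleLeaders

variable {n : ℕ}

theorem mem_cycleLeaders {σ : Equiv.Perm (Fin n)} {i x : Fin n} :
    x ∈ cycleLeaders σ i ↔ ¬ σ.SameCycle i x ∧ ∀ y, σ.SameCycle x y → x ≤ y := by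
  simp [cycleLeaders]

theorem nodup_cycleLeaders (σ : Equiv.Perm (Fin n)) (i : Fin n) : (cycleLeaders σ i).Nodup :=
  (List.nodup_finRange n).filter _

theorem cycleLeaders_congr {σ τ : Equiv.Perm (Fin n)}
    (h : ∀ x y, τ.SameCycle x y ↔ σ.SameCycle x y) (i : Fin n) :
    cycleLeaders τ i = cycleLeaders σ i := by
  unfold cycleLeaders
  simp only [h]

theorem cycleLeaders_inv (σ : Equiv.Perm (Fin n)) (i : Fin n) :
    cycleLeaders σ⁻¹ i = cycleLeaders σ i :=
  cycleLeaders_congr (fun _ _ => Equiv.Perm.sameCycle_inv) i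

theorem cycleLeaders_reverseCycle (σ : Equiv.Perm (Fin n)) (x i : Fin n) :
    cycleLeaders (σ.reverseCycle x) i = cycleLeaders σ i :=
  cycleLeaders_congr (fun _ _ => Equiv.Perm.sameCycle_reverseCycle) i

open Classical in
/-- The set of the minimal elements of the cycles of `σ`. -/
noncomputable def cycleMins (σ : Equiv.Perm (Fin n)) : Finset (Fin n) :=
  Finset.univ.filter fun x => ∀ y, σ.SameCycle x y → x ≤ y

theorem mem_cycleMins {σ : Equiv.Perm (Fin n)} {x : Fin n} :
    x ∈ cycleMins σ ↔ ∀ y, σ.SameCycle x y → x ≤ y := by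
  simp [cycleMins]

theorem exists_mem_cycleMins (σ : Equiv.Perm (Fin n)) (j : Fin n) :
    ∃ x ∈ cycleMins σ, σ.SameCycle x j := by
  classical
  have hne : (Finset.univ.filter fun x => σ.SameCycle j x).Nonempty :=
    ⟨j, by simp [Equiv.Perm.SameCycle.refl]⟩
  refine ⟨Finset.min' _ hne, ?_, ?_⟩
  · rw [mem_cycleMins]
    intro y hy
    refine Finset.min'_le _ _ ?_
    have := Finset.min'_mem _ hne
    simp only [Finset.mem_filter, Finset.mem_univ, true_and] at this ⊢
    exact this.trans hy
  · have := Finset.min'_mem _ hne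
    simp only [Finset.mem_filter, Finset.mem_univ, true_and] at this
    exact this.symm

theorem eq_of_mem_cycleMins {σ : Equiv.Perm (Fin n)} {x y : Fin n} (hx : x ∈ cycleMins σ)
    (hy : y ∈ cycleMins σ) (h : σ.SameCycle x y) : x = y :=
  le_antisymm (mem_cycleMins.1 hx y h) (mem_cycleMins.1 hy x h.symm)

/-- Real parts commute, so products of them can be taken over a `Finset`, without the order of the
list. -/
theorem toFinset_cycleLeaders {σ : Equiv.Perm (Fin n)} {j x : Fin n} (hx : x ∈ cycleMins σ)
    (hxj : σ.SameCycle x j) : (cycleLeaders σ j).toFinset = (cycleMins σ).erase x := by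
  ext y
  rw [List.mem_toFinset, mem_cycleLeaders, Finset.mem_erase, ← mem_cycleMins]
  refine and_congr_left fun hy => not_congr ⟨fun h => ?_, fun h => ?_⟩
  · exact (eq_of_mem_cycleMins hx hy (hxj.trans h)).symm
  · exact h ▸ hxj.symm

end CycleLeaders

/-! ### Conjugation exchanges row and column determinants. -/

section StarDet

variable {R : Type*} [Ring R] [StarRing R] {n : ℕ}

theorem star_cdet (M : Matrix (Fin n) (Fin n) R) (j : Fin n) : star (cdet j M) = rdet j Mᴴ := by
  unfold cdet rdet
  rw [star_sum]
  refine Fintype.sum_equiv (Equiv.inv _) _ _ fun σ => ?_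
  rw [Equiv.inv_apply, Equiv.Perm.sign_inv, star_zsmul, star_mul, star_cycleProd, cycleLeaders_inv]
  congr 2
  induction cycleLeaders σ j with
  | nil => simp
  | cons x L ih =>
    simp only [List.reverse_cons, List.map_append, List.prod_append, star_mul, ih, List.map_cons,
      List.prod_cons, List.map_nil, List.prod_nil, mul_one, star_cycleProd]

theorem rdet_eq_star_cdet (M : Matrix (Fin n) (Fin n) R) (j : Fin n) :
    rdet j M = star (cdet j Mᴴ) := by
  rw [star_cdet, Matrix.conjTranspose_conjTranspose]

end StarDet

/-! ### Reduction of column determinants to the Moore determinant. -/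

section Quaternion

variable {R : Type*} [CommRing R] {a b : R} {n : ℕ}

theorem QuaternionAlgebra.re_mul_comm (x y : ℍ[R,a,b]) : (x * y).re = (y * x).re := by
  simp only [QuaternionAlgebra.re_mul]
  ring

theorem QuaternionAlgebra.add_star_eq (x : ℍ[R,a,b]) : x + star x = (x.re : ℍ[R,a,b]) + x.re := by
  rw [QuaternionAlgebra.self_add_star', zero_mul, add_zero, two_mul, QuaternionAlgebra.coe_add]

theorem QuaternionAlgebra.coe_list_prod (L : List R) :
    ((L.prod : R) : ℍ[R,a,b]) = (L.map fun x : R => (x : ℍ[R,a,b])).prod := by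
  induction L with
  | nil => simp
  | cons x L ih => simp [ih]

/-- A sum over a set with a permutation that changes the sign of the summands vanishes. -/
theorem QuaternionAlgebra.sum_eq_zero_of_perm [IsDomain R] [CharZero R] {ι : Type*} [Fintype ι]
    (e : Equiv.Perm ι) (f : ι → ℍ[R,a,b]) (h : ∀ i, f i + f (e i) = 0) : ∑ i, f i = 0 := by
  have h1 : ∑ i, f i + ∑ i, f i = 0 := by
    conv_lhs => rw [← Equiv.sum_comp e f]
    nth_rewrite 1 [Equiv.sum_comp e f]
    rw [← Finset.sum_add_distrib]
    exact Finset.sum_eq_zero fun i _ => h i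
  -- Reindexing only gives that twice the sum vanishes; here the factor two is cancelled.
  have h2 : ∀ r : R, r + r = 0 → r = 0 := fun r hr => by
    rw [← two_mul] at hr
    exact (mul_eq_zero.1 hr).resolve_left two_ne_zero
  ext
  · exact h2 _ (congrArg QuaternionAlgebra.re h1)
  · exact h2 _ (congrArg QuaternionAlgebra.imI h1)
  · exact h2 _ (congrArg QuaternionAlgebra.imJ h1)
  · exact h2 _ (congrArg QuaternionAlgebra.imK h1)

theorem re_cycleProd_of_sameCycle (M : Matrix (Fin n) (Fin n) ℍ[R,a,b]) {σ : Equiv.Perm (Fin n)}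
    {x y : Fin n} (h : σ.SameCycle x y) : (cycleProd M σ y).re = (cycleProd M σ x).re := by
  obtain ⟨k, rfl⟩ := Equiv.Perm.sameCycle_iff_exists_nat_pow.1 h
  clear h
  induction k with
  | zero => simp
  | succ k ih =>
    obtain ⟨u, hu, hu'⟩ := cycleProd_apply_eq M σ ((σ ^ k) x)
    rw [Equiv.Perm.pow_succ_apply, hu', QuaternionAlgebra.re_mul_comm, ← hu, ih]

/-- The product of the real parts of the products along the cycles that do not contain `j`. -/
noncomputable def cycleReProd (M : Matrix (Fin n) (Fin n) ℍ[R,a,b]) (σ : Equiv.Perm (Fin n))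
    (j : Fin n) : R :=
  ((cycleLeaders σ j).map fun x => (cycleProd M σ x).re).prod

/-- The Moore determinant: the signed sum over all permutations of the products of the real parts
of the products along the cycles. -/
noncomputable def mooreDet (M : Matrix (Fin n) (Fin n) ℍ[R,a,b]) : R :=
  ∑ σ : Equiv.Perm (Fin n), (Equiv.Perm.sign σ : ℤ) •
    ∏ x ∈ cycleMins σ, (cycleProd M σ x).re

theorem cycleReProd_eq_prod_erase (M : Matrix (Fin n) (Fin n) ℍ[R,a,b]) {σ : Equiv.Perm (Fin n)}
    {j x : Fin n} (hx : x ∈ cycleMins σ) (hxj : σ.SameCycle x j) :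
    cycleReProd M σ j = ∏ y ∈ (cycleMins σ).erase x, (cycleProd M σ y).re := by
  rw [cycleReProd, ← toFinset_cycleLeaders hx hxj, List.prod_toFinset _ (nodup_cycleLeaders σ j)]

theorem cycleReProd_mul_re (M : Matrix (Fin n) (Fin n) ℍ[R,a,b]) (σ : Equiv.Perm (Fin n))
    (j : Fin n) :
    cycleReProd M σ j * (cycleProd M σ j).re = ∏ x ∈ cycleMins σ, (cycleProd M σ x).re := by
  obtain ⟨x, hx, hxj⟩ := exists_mem_cycleMins σ j
  rw [cycleReProd_eq_prod_erase M hx hxj, re_cycleProd_of_sameCycle M hxj, mul_comm]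
  exact Finset.mul_prod_erase _ (fun x => (cycleProd M σ x).re) hx

theorem cycleReProd_congr {M N : Matrix (Fin n) (Fin n) ℍ[R,a,b]} {σ τ : Equiv.Perm (Fin n)}
    {i j : Fin n} (hl : cycleLeaders σ i = cycleLeaders τ j)
    (h : ∀ x ∈ cycleLeaders τ j, cycleProd M σ x = cycleProd N τ x) :
    cycleReProd M σ i = cycleReProd N τ j := by
  rw [cycleReProd, cycleReProd, hl]
  exact congrArg List.prod (List.map_congr_left fun x hx => by rw [h x hx])

theorem cycleReProd_updateCol (M : Matrix (Fin n) (Fin n) ℍ[R,a,b]) (c : Fin n → ℍ[R,a,b])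
    (σ : Equiv.Perm (Fin n)) (j : Fin n) :
    cycleReProd (M.updateCol j c) σ j = cycleReProd M σ j :=
  cycleReProd_congr rfl fun _ hx =>
    cycleProd_updateCol_of_not_sameCycle M c (mem_cycleLeaders.1 hx).1

theorem cycleReProd_reverseCycle_self (M : Matrix (Fin n) (Fin n) ℍ[R,a,b])
    (σ : Equiv.Perm (Fin n)) (j : Fin n) :
    cycleReProd M (σ.reverseCycle j) j = cycleReProd M σ j :=
  cycleReProd_congr (cycleLeaders_reverseCycle σ j j) fun _ hx =>
    cycleProd_reverseCycle_of_not_sameCycle M (mem_cycleLeaders.1 hx).1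

/-- A summand of the column determinant, with the products along the cycles whose minimal elements
are less than `m` replaced by their real parts. -/
noncomputable def cdetTerm (N : Matrix (Fin n) (Fin n) ℍ[R,a,b]) (j : Fin n) (m : ℕ)
    (σ : Equiv.Perm (Fin n)) : ℍ[R,a,b] :=
  (Equiv.Perm.sign σ : ℤ) • (((cycleLeaders σ j).reverse.map fun x : Fin n =>
    if (x : ℕ) < m then ((cycleProd N σ x).re : ℍ[R,a,b]) else cycleProd N σ x).prod *
      cycleProd N σ j)

theorem cdetTerm_succ_of_notMem (N : Matrix (Fin n) (Fin n) ℍ[R,a,b]) {j k : Fin n}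
    {σ : Equiv.Perm (Fin n)} (hk : k ∉ cycleLeaders σ j) :
    cdetTerm N j (k + 1) σ = cdetTerm N j k σ := by
  unfold cdetTerm
  congr 3
  refine List.map_congr_left fun x hx => ?_
  have hxk : (x : ℕ) ≠ k := fun h => hk (Fin.ext h ▸ List.mem_reverse.1 hx)
  have : (x : ℕ) < k + 1 ↔ (x : ℕ) < k := by omega
  simp only [this]

/-- The two summands differ only in the factor at `k`, which is `P` in one and `star P` in the
other; their sum is unchanged if both are replaced by the common real part. -/
theorem cdetTerm_add_reverseCycle {N : Matrix (Fin n) (Fin n) ℍ[R,a,b]} {j k : Fin n}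
    (hN : ∀ x y, x ≠ j → y ≠ j → N x y = star (N y x)) {σ : Equiv.Perm (Fin n)}
    (hk : k ∈ cycleLeaders σ j) :
    cdetTerm N j k σ + cdetTerm N j k (σ.reverseCycle k) =
      cdetTerm N j (k + 1) σ + cdetTerm N j (k + 1) (σ.reverseCycle k) := by
  have hjk : ¬ σ.SameCycle j k := (mem_cycleLeaders.1 hk).1
  have hne : ∀ y, σ.SameCycle k y → y ≠ j := fun y hy h => hjk (h ▸ hy.symm)
  have hself : cycleProd N (σ.reverseCycle k) k = star (cycleProd N σ k) :=
    cycleProd_reverseCycle_self fun y z hy hz => hN y z (hne y hy) (hne z hz)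
  have hoff : ∀ x ∈ cycleLeaders σ j, x ≠ k →
      cycleProd N (σ.reverseCycle k) x = cycleProd N σ x := fun x hx hxk => by
    refine cycleProd_reverseCycle_of_not_sameCycle N fun h => hxk ?_
    exact (eq_of_mem_cycleMins (mem_cycleMins.2 (mem_cycleLeaders.1 hk).2)
      (mem_cycleMins.2 (mem_cycleLeaders.1 hx).2) h).symm
  obtain ⟨L₁, L₂, hL⟩ := List.append_of_mem (List.mem_reverse.2 hk)
  have hnd : (L₁ ++ k :: L₂).Nodup := hL ▸ List.nodup_reverse.2 (nodup_cycleLeaders σ j)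
  have hk₁ : ∀ x ∈ L₁, x ≠ k ∧ x ∈ cycleLeaders σ j := fun x hx => by
    refine ⟨fun h => ?_, List.mem_reverse.1 (hL ▸ by simp [hx])⟩
    subst h
    simp [List.nodup_append] at hnd
    exact (hnd.2.2 x hx).1 rfl
  have hk₂ : ∀ x ∈ L₂, x ≠ k ∧ x ∈ cycleLeaders σ j := fun x hx => by
    refine ⟨fun h => ?_, List.mem_reverse.1 (hL ▸ by simp [hx])⟩
    subst h
    simp [List.nodup_append] at hnd
    exact hnd.2.1.1 hx
  -- Away from `k`, neither the threshold nor the reversal affects a factor.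
  have key : ∀ (L : List (Fin n)) (m : ℕ) (τ : Equiv.Perm (Fin n)),
      (m = k ∨ m = k + 1) → (τ = σ ∨ τ = σ.reverseCycle k) →
      (∀ x ∈ L, x ≠ k ∧ x ∈ cycleLeaders σ j) →
      (L.map fun x : Fin n => if (x : ℕ) < m then ((cycleProd N τ x).re : ℍ[R,a,b])
        else cycleProd N τ x) =
      L.map fun x : Fin n => if (x : ℕ) < k then ((cycleProd N σ x).re : ℍ[R,a,b])
        else cycleProd N σ x := by
    intro L m τ hm hτ hLk
    refine List.map_congr_left fun x hx => ?_
    obtain ⟨hxk, hxl⟩ := hLk x hx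
    have h1 : cycleProd N τ x = cycleProd N σ x := by
      rcases hτ with rfl | rfl
      · rfl
      · exact hoff x hxl hxk
    have hxk' : (x : ℕ) ≠ k := fun h => hxk (Fin.ext h)
    have h2 : (x : ℕ) < m ↔ (x : ℕ) < k := by omega
    simp only [h1, h2]
  unfold cdetTerm
  rw [Equiv.Perm.sign_reverseCycle, cycleLeaders_reverseCycle, hL,
    cycleProd_reverseCycle_of_not_sameCycle N fun h => hjk h.symm]
  simp only [List.map_append, List.map_cons, List.prod_append, List.prod_cons]
  rw [key L₁ k σ (by simp) (by simp) hk₁, key L₂ k σ (by simp) (by simp) hk₂,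
    key L₁ k (σ.reverseCycle k) (by simp) (by simp) hk₁,
    key L₂ k (σ.reverseCycle k) (by simp) (by simp) hk₂,
    key L₁ (k + 1) σ (by simp) (by simp) hk₁, key L₂ (k + 1) σ (by simp) (by simp) hk₂,
    key L₁ (k + 1) (σ.reverseCycle k) (by simp) (by simp) hk₁,
    key L₂ (k + 1) (σ.reverseCycle k) (by simp) (by simp) hk₂]
  have hre : (star (cycleProd N σ k)).re = (cycleProd N σ k).re := by simp
  simp only [lt_irrefl, if_false, Nat.lt_succ_self, if_true, hself, hre]
  rw [← smul_add, ← smul_add, ← add_mul, ← mul_add, ← add_mul, ← add_mul, ← mul_add, ← add_mul,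
    QuaternionAlgebra.add_star_eq]

variable [IsDomain R] [CharZero R]

theorem sum_cdetTerm_succ {N : Matrix (Fin n) (Fin n) ℍ[R,a,b]} {j : Fin n}
    (hN : ∀ x y, x ≠ j → y ≠ j → N x y = star (N y x)) (k : Fin n) :
    ∑ σ, cdetTerm N j k σ = ∑ σ, cdetTerm N j (k + 1) σ := by
  rw [← sub_eq_zero, ← Finset.sum_sub_distrib]
  refine QuaternionAlgebra.sum_eq_zero_of_perm (Equiv.Perm.reverseCycleEquiv k) _ fun σ => ?_
  rw [Equiv.Perm.reverseCycleEquiv_apply]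
  by_cases hk : k ∈ cycleLeaders σ j
  · rw [sub_add_sub_comm, cdetTerm_add_reverseCycle hN hk, sub_self]
  · have hk' : k ∉ cycleLeaders (σ.reverseCycle k) j := by rwa [cycleLeaders_reverseCycle]
    rw [cdetTerm_succ_of_notMem N hk, cdetTerm_succ_of_notMem N hk', sub_self, sub_self, add_zero]

/-- The threshold in `cdetTerm` is raised from `0`, the original summands, to `n`, where all factors
but the last are real parts. Row and column `j` are left free, so column `j` can later be replaced.
-/
theorem cdet_eq_sum_cycleReProd {N : Matrix (Fin n) (Fin n) ℍ[R,a,b]} {j : Fin n}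
    (hN : ∀ x y, x ≠ j → y ≠ j → N x y = star (N y x)) :
    cdet j N = ∑ σ : Equiv.Perm (Fin n),
      (Equiv.Perm.sign σ : ℤ) • cycleReProd N σ j • cycleProd N σ j := by
  have h : ∀ m ≤ n, cdet j N = ∑ σ, cdetTerm N j m σ := by
    intro m
    induction m with
    | zero => intro _; simp [cdet, cdetTerm]
    | succ m ih => intro hm; rw [ih (by omega), sum_cdetTerm_succ hN ⟨m, by omega⟩]
  rw [h n le_rfl]
  refine Finset.sum_congr rfl fun σ _ => ?_
  simp only [cdetTerm, Fin.is_lt, if_true]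
  rw [cycleReProd, ← QuaternionAlgebra.coe_mul_eq_smul, ← (List.reverse_perm _).prod_eq,
    QuaternionAlgebra.coe_list_prod, ← List.map_reverse, List.map_map]
  rfl

theorem cdet_updateCol_eq_sum {M : Matrix (Fin n) (Fin n) ℍ[R,a,b]} (hM : Mᴴ = M) (j : Fin n)
    (c : Fin n → ℍ[R,a,b]) :
    cdet j (M.updateCol j c) = ∑ σ : Equiv.Perm (Fin n),
      (Equiv.Perm.sign σ : ℤ) • cycleReProd M σ j • (cyclePrefix M σ j * c (σ⁻¹ j)) := by
  rw [cdet_eq_sum_cycleReProd]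
  · simp only [cycleReProd_updateCol, cycleProd_updateCol_self]
  · intro x y hx hy
    rw [Matrix.updateCol_ne hx, Matrix.updateCol_ne hy, ← Matrix.conjTranspose_apply, hM]

/-- When row and column `j` are Hermitian too, the cycle through `j` can also be reversed, and the
last factor becomes a real part. -/
theorem cdet_eq_mooreDet {M : Matrix (Fin n) (Fin n) ℍ[R,a,b]} (hM : Mᴴ = M) (j : Fin n) :
    cdet j M = ((mooreDet M : R) : ℍ[R,a,b]) := by
  have hM' : ∀ x y, M x y = star (M y x) := fun x y => by
    rw [← Matrix.conjTranspose_apply, hM]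
  rw [cdet_eq_sum_cycleReProd fun x y _ _ => hM' x y, mooreDet,
    ← QuaternionAlgebra.coe_algebraMap, map_sum, ← sub_eq_zero, ← Finset.sum_sub_distrib]
  refine QuaternionAlgebra.sum_eq_zero_of_perm (Equiv.Perm.reverseCycleEquiv j) _ fun σ => ?_
  have hstar : cycleProd M (σ.reverseCycle j) j = star (cycleProd M σ j) :=
    cycleProd_reverseCycle_self fun y z _ _ => hM' y z
  have hre : (star (cycleProd M σ j)).re = (cycleProd M σ j).re := by simp
  simp only [Equiv.Perm.reverseCycleEquiv_apply, ← cycleReProd_mul_re M _ j, map_zsmul,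
    Equiv.Perm.sign_reverseCycle, hstar, hre, cycleReProd_reverseCycle_self,
    QuaternionAlgebra.coe_algebraMap, QuaternionAlgebra.coe_mul, QuaternionAlgebra.coe_mul_eq_smul]
  rw [← smul_sub, ← smul_sub, ← smul_sub, ← smul_sub, ← smul_add, ← smul_add, sub_add_sub_comm,
    QuaternionAlgebra.add_star_eq, sub_self, smul_zero, smul_zero]

end Quaternion

/-! ### Column determinants with two equal columns. -/

section Merge

variable {R : Type*} [CommRing R] {a b : R} {n : ℕ}

theorem mem_cycleLeaders_swap_mul {σ : Equiv.Perm (Fin n)} {j l x : Fin n}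
    (h : ¬ σ.SameCycle j l) :
    x ∈ cycleLeaders (Equiv.swap j l * σ) j ↔ x ∈ cycleLeaders σ j ∧ ¬ σ.SameCycle l x := by
  rw [mem_cycleLeaders, mem_cycleLeaders, Equiv.Perm.sameCycle_swap_mul_left h, not_or]
  constructor
  · rintro ⟨⟨h1, h2⟩, h3⟩
    refine ⟨⟨h1, fun y hy => h3 y ?_⟩, h2⟩
    rwa [Equiv.Perm.sameCycle_iff_of_agree (Equiv.Perm.swap_mul_agree h1 h2)]
  · rintro ⟨⟨h1, h3⟩, h2⟩
    refine ⟨⟨h1, h2⟩, fun y hy => h3 y ?_⟩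
    rwa [Equiv.Perm.sameCycle_iff_of_agree (Equiv.Perm.swap_mul_agree h1 h2)] at hy

/-- Merging absorbs the cycle of `l` into that of `j`, which `cycleReProd` omits; exactly one leader
is lost. -/
theorem cycleReProd_swap_mul (N : Matrix (Fin n) (Fin n) ℍ[R,a,b]) {σ : Equiv.Perm (Fin n)}
    {j l : Fin n} (h : ¬ σ.SameCycle j l) :
    cycleReProd N σ j = cycleReProd N (Equiv.swap j l * σ) j * (cycleProd N σ l).re := by
  obtain ⟨x, hx, hxl⟩ := exists_mem_cycleMins σ l
  have hxmem : x ∈ (cycleLeaders σ j).toFinset := by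
    rw [List.mem_toFinset, mem_cycleLeaders]
    exact ⟨fun h' => h (h'.trans hxl), mem_cycleMins.1 hx⟩
  have hset : (cycleLeaders (Equiv.swap j l * σ) j).toFinset =
      (cycleLeaders σ j).toFinset.erase x := by
    ext y
    rw [Finset.mem_erase, List.mem_toFinset, List.mem_toFinset, mem_cycleLeaders_swap_mul h,
      and_comm]
    refine and_congr_left fun hy => not_congr ⟨fun h' => ?_, fun h' => ?_⟩
    · exact (eq_of_mem_cycleMins hx (mem_cycleMins.2 (mem_cycleLeaders.1 hy).2)
        (hxl.trans h')).symm
    · exact h' ▸ hxl.symm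
  have h1 : cycleReProd N (Equiv.swap j l * σ) j =
      ∏ y ∈ (cycleLeaders σ j).toFinset.erase x, (cycleProd N σ y).re := by
    rw [cycleReProd, ← List.prod_toFinset _ (nodup_cycleLeaders _ j), ← hset]
    refine Finset.prod_congr rfl fun y hy => ?_
    rw [List.mem_toFinset, mem_cycleLeaders_swap_mul h] at hy
    rw [cycleProd_of_agree N (Equiv.Perm.swap_mul_agree (mem_cycleLeaders.1 hy.1).1 hy.2)]
  rw [h1, cycleReProd, ← List.prod_toFinset _ (nodup_cycleLeaders _ j),
    re_cycleProd_of_sameCycle N hxl]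
  exact (Finset.prod_erase_mul _ (fun y => (cycleProd N σ y).re) hxmem).symm

theorem cycleReProd_swap_mul_reverseCycle (N : Matrix (Fin n) (Fin n) ℍ[R,a,b])
    {σ : Equiv.Perm (Fin n)} {j l : Fin n} (h : ¬ σ.SameCycle j l) :
    cycleReProd N (Equiv.swap j l * σ.reverseCycle l) j =
      cycleReProd N (Equiv.swap j l * σ) j := by
  have h' : ¬ (σ.reverseCycle l).SameCycle j l :=
    fun h' => h (Equiv.Perm.sameCycle_reverseCycle.1 h')
  have hmem : ∀ x, x ∈ cycleLeaders (Equiv.swap j l * σ.reverseCycle l) j ↔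
      x ∈ cycleLeaders (Equiv.swap j l * σ) j := fun x => by
    rw [mem_cycleLeaders_swap_mul h, mem_cycleLeaders_swap_mul h', cycleLeaders_reverseCycle,
      Equiv.Perm.sameCycle_reverseCycle]
  rw [cycleReProd, cycleReProd, ← List.prod_toFinset _ (nodup_cycleLeaders _ j),
    ← List.prod_toFinset _ (nodup_cycleLeaders _ j)]
  refine Finset.prod_congr (by ext x; simp only [List.mem_toFinset, hmem]) fun x hx => ?_
  rw [List.mem_toFinset, mem_cycleLeaders_swap_mul h] at hx
  have hx1 := (mem_cycleLeaders.1 hx.1).1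
  rw [cycleProd_of_agree N (Equiv.Perm.swap_mul_agree hx1 hx.2),
    cycleProd_of_agree N (Equiv.Perm.swap_mul_agree
      (fun h => hx1 (Equiv.Perm.sameCycle_reverseCycle.1 h))
      (fun h => hx.2 (Equiv.Perm.sameCycle_reverseCycle.1 h))),
    cycleProd_reverseCycle_of_not_sameCycle N hx.2]

/-- A column determinant with two equal columns vanishes if the matrix is Hermitian outside of the
row and the column of the determinant. -/
theorem cdet_eq_zero_of_column_eq [IsDomain R] [CharZero R] {N : Matrix (Fin n) (Fin n) ℍ[R,a,b]}
    {j l : Fin n} (hjl : j ≠ l) (hN : ∀ x y, x ≠ j → y ≠ j → N x y = star (N y x))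
    (hcol : ∀ x, N x j = N x l) : cdet j N = 0 := by
  classical
  rw [cdet_eq_sum_cycleReProd hN]
  set f : Equiv.Perm (Fin n) → ℍ[R,a,b] := fun σ =>
    (Equiv.Perm.sign σ : ℤ) • cycleReProd N σ j • cycleProd N σ j with hf
  -- Multiplication by `swap j l` matches the permutations with `j` and `l` in one cycle to those
  -- with `j` and `l` in different cycles.
  have hsplit : ∑ σ, f σ =
      ∑ σ, if σ.SameCycle j l then 0 else f σ + f (Equiv.swap j l * σ) := by
    have h1 : ∑ σ : Equiv.Perm (Fin n), (if σ.SameCycle j l then f σ else 0) =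
        ∑ σ, if σ.SameCycle j l then 0 else f (Equiv.swap j l * σ) := by
      rw [← Equiv.sum_comp (Equiv.mulLeft (Equiv.swap j l))]
      refine Finset.sum_congr rfl fun σ _ => ?_
      simp only [Equiv.coe_mulLeft, Equiv.Perm.sameCycle_swap_mul_iff hjl, ite_not]
    have h2 : ∑ σ, f σ = ∑ σ : Equiv.Perm (Fin n), (if σ.SameCycle j l then f σ else 0) +
        ∑ σ : Equiv.Perm (Fin n), (if σ.SameCycle j l then 0 else f σ) := by
      rw [← Finset.sum_add_distrib]
      refine Finset.sum_congr rfl fun σ _ => ?_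
      split_ifs <;> simp
    rw [h2, h1, add_comm, ← Finset.sum_add_distrib]
    refine Finset.sum_congr rfl fun σ _ => ?_
    split_ifs <;> simp
  -- The signs are opposite and the merged product is the product of the two, so only the real part
  -- minus the product itself survives for the cycle of `l`.
  have hpair : ∀ σ : Equiv.Perm (Fin n), ¬ σ.SameCycle j l → f σ + f (Equiv.swap j l * σ) =
      (Equiv.Perm.sign σ : ℤ) • cycleReProd N (Equiv.swap j l * σ) j •
        (cycleProd N σ j * (((cycleProd N σ l).re : ℍ[R,a,b]) - cycleProd N σ l)) := by
    intro σ h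
    simp only [hf]
    rw [cycleProd_swap_mul h hcol, cycleReProd_swap_mul N h, Equiv.Perm.sign_mul,
      Equiv.Perm.sign_swap hjl, mul_sub, smul_sub, smul_sub, QuaternionAlgebra.mul_coe_eq_smul,
      mul_smul]
    simp [sub_eq_add_neg]
  rw [hsplit]
  -- Reversing the cycle of `l` replaces `re P - P` by `re P - star P`, its negative.
  refine QuaternionAlgebra.sum_eq_zero_of_perm (Equiv.Perm.reverseCycleEquiv l) _ fun σ => ?_
  rw [Equiv.Perm.reverseCycleEquiv_apply]
  by_cases h : σ.SameCycle j l
  · rw [if_pos h, if_pos (Equiv.Perm.sameCycle_reverseCycle.2 h), add_zero]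
  · have h' : ¬ (σ.reverseCycle l).SameCycle j l :=
      fun h' => h (Equiv.Perm.sameCycle_reverseCycle.1 h')
    have hne : ∀ y, σ.SameCycle l y → y ≠ j := fun y hy hy' => h (hy' ▸ hy.symm)
    have hstar : cycleProd N (σ.reverseCycle l) l = star (cycleProd N σ l) :=
      cycleProd_reverseCycle_self fun y z hy hz => hN y z (hne y hy) (hne z hz)
    have hre : (star (cycleProd N σ l)).re = (cycleProd N σ l).re := by simp
    rw [if_neg h, if_neg h', hpair σ h, hpair _ h', cycleReProd_swap_mul_reverseCycle N h,
      cycleProd_reverseCycle_of_not_sameCycle N (fun h' => h h'.symm), hstar, hre,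
      Equiv.Perm.sign_reverseCycle, ← smul_add, ← smul_add, ← mul_add, sub_add_sub_comm,
      QuaternionAlgebra.add_star_eq, sub_self, mul_zero, smul_zero, smul_zero]

end Merge

/-! ### The left adjugate. -/

section Adjugate

variable {n : ℕ}

/-- The matrix of the left cofactors: its `(j, k)` entry is the coefficient of the `(k, j)` entry
of the matrix in the `j`-th column determinant. -/
noncomputable def cdetAdjugate {R : Type*} [Ring R] (M : Matrix (Fin n) (Fin n) R) :
    Matrix (Fin n) (Fin n) R :=
  Matrix.of fun j k => cdet j (M.updateCol j (Pi.single k 1))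

theorem cdet_updateCol {R : Type*} [Ring R] (M : Matrix (Fin n) (Fin n) R) (j : Fin n)
    (c : Fin n → R) : cdet j (M.updateCol j c) = ∑ k, cdetAdjugate M j k * c k := by
  have key : ∀ c : Fin n → R, cdet j (M.updateCol j c) = ∑ σ : Equiv.Perm (Fin n),
      (Equiv.Perm.sign σ : ℤ) • (((cycleLeaders σ j).reverse.map (cycleProd M σ)).prod *
        cyclePrefix M σ j * c (σ⁻¹ j)) := fun c => by
    refine Finset.sum_congr rfl fun σ _ => ?_
    rw [cycleProd_updateCol_self, mul_assoc]
    congr 3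
    refine List.map_congr_left fun x hx => ?_
    exact cycleProd_updateCol_of_not_sameCycle M c
      (mem_cycleLeaders.1 (List.mem_reverse.1 hx)).1
  simp only [cdetAdjugate, Matrix.of_apply, key, Finset.sum_mul]
  rw [Finset.sum_comm]
  refine Finset.sum_congr rfl fun σ _ => ?_
  rw [Finset.sum_eq_single (σ⁻¹ j)]
  · rw [Pi.single_eq_same, mul_one, smul_mul_assoc]
  · intro k _ hk
    rw [Pi.single_eq_of_ne hk.symm, mul_zero, smul_zero, zero_mul]
  · simp

variable {R : Type*} [CommRing R] {a b : R} [IsDomain R] [CharZero R]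

/-- Expansion along column `j`: off the diagonal, column `j` is replaced by column `l`, which leaves
the matrix Hermitian outside row and column `j`, as the vanishing lemma demands. -/
theorem cdetAdjugate_mul {M : Matrix (Fin n) (Fin n) ℍ[R,a,b]} (hM : Mᴴ = M) :
    cdetAdjugate M * M = mooreDet M • (1 : Matrix (Fin n) (Fin n) ℍ[R,a,b]) := by
  ext1 j l
  rw [Matrix.mul_apply, ← cdet_updateCol M j fun k => M k l, Matrix.smul_apply]
  by_cases hjl : j = l
  · subst hjl
    have : M.updateCol j (fun k => M k j) = M := Matrix.updateCol_eq_self M j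
    rw [this, cdet_eq_mooreDet hM, Matrix.one_apply_eq, ← QuaternionAlgebra.coe_mul_eq_smul,
      mul_one]
  · rw [Matrix.one_apply_ne hjl, smul_zero]
    refine cdet_eq_zero_of_column_eq hjl (fun x y hx hy => ?_) fun x => ?_
    · rw [Matrix.updateCol_ne hx, Matrix.updateCol_ne hy, ← Matrix.conjTranspose_apply, hM]
    · rw [Matrix.updateCol_self, Matrix.updateCol_ne (Ne.symm hjl)]

end Adjugate

/-! ### Jacobi's formula for the Moore determinant. -/

theorem derivation_prod {K S ι : Type*} [CommRing K] [CommRing S] [Algebra K S] [DecidableEq ι]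
    (d : Derivation K S S) (s : Finset ι) (f : ι → S) :
    d (∏ i ∈ s, f i) = ∑ i ∈ s, (∏ j ∈ s.erase i, f j) * d (f i) := by
  induction s using Finset.induction_on with
  | empty => simp
  | insert i s hi ih =>
    rw [Finset.prod_insert hi, Derivation.leibniz, ih, Finset.sum_insert hi,
      Finset.erase_insert hi, smul_eq_mul, smul_eq_mul, Finset.mul_sum, add_comm]
    congr 1
    refine Finset.sum_congr rfl fun j hj => ?_
    rw [Finset.erase_insert_of_ne (ne_of_mem_of_not_mem hj hi).symm,
      Finset.prod_insert (fun h => hi (Finset.mem_of_mem_erase h)), mul_assoc]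

section Derivation

variable {K S : Type*} [CommRing K] [CommRing S] [Algebra K S] {a b : S} {n : ℕ}

/-- The coordinatewise extension of a derivation to a quaternion algebra. -/
def quatDeriv (d : Derivation K S S) : ℍ[S,a,b] →+ ℍ[S,a,b] where
  toFun x := ⟨d x.re, d x.imI, d x.imJ, d x.imK⟩
  map_zero' := by ext <;> simp
  map_add' x y := by ext <;> simp

theorem re_quatDeriv (d : Derivation K S S) (x : ℍ[S,a,b]) : (quatDeriv d x).re = d x.re := rfl

theorem QuaternionAlgebra.re_sum {S : Type*} [CommRing S] {a b : S} {ι : Type*}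
    (s : Finset ι) (f : ι → ℍ[S,a,b]) :
    (∑ k ∈ s, f k).re = ∑ k ∈ s, (f k).re :=
  map_sum (QuaternionAlgebra.reₗ (R := S) a 0 b) f s

theorem quatDeriv_star (d : Derivation K S S) (x : ℍ[S,a,b]) :
    quatDeriv d (star x) = star (quatDeriv d x) := by
  ext <;> simp [quatDeriv]

theorem quatDeriv_mul {d : Derivation K S S} (ha : d a = 0) (hb : d b = 0) (x y : ℍ[S,a,b]) :
    quatDeriv d (x * y) = quatDeriv d x * y + x * quatDeriv d y := by
  ext <;> simp [quatDeriv, ha, hb] <;> ring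

theorem quatDeriv_one (d : Derivation K S S) : quatDeriv d (1 : ℍ[S,a,b]) = 0 := by
  ext <;> simp [quatDeriv]

theorem quatDeriv_prod_map_range {d : Derivation K S S} (ha : d a = 0) (hb : d b = 0)
    (f : ℕ → ℍ[S,a,b]) (p : ℕ) :
    quatDeriv d ((List.range p).map f).prod = ∑ k ∈ Finset.range p,
      ((List.range k).map f).prod * quatDeriv d (f k) *
        ((List.range (p - 1 - k)).map fun i => f (k + 1 + i)).prod := by
  induction p with
  | zero => simp [quatDeriv_one]
  | succ p ih =>
    rw [List.prod_range_succ, quatDeriv_mul ha hb, ih, Finset.sum_range_succ, Finset.sum_mul]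
    congr 1
    · refine Finset.sum_congr rfl fun k hk => ?_
      have hk := Finset.mem_range.1 hk
      have h1 : p + 1 - 1 - k = (p - 1 - k) + 1 := by omega
      have h2 : k + 1 + (p - 1 - k) = p := by omega
      rw [h1, List.prod_range_succ, h2, mul_assoc, mul_assoc]
    · simp

/-- The Leibniz rule differentiates one factor at a time. Under the real part the product can be
rotated until that factor is last, and the others form the prefix. -/
theorem re_quatDeriv_cycleProd {d : Derivation K S S} (ha : d a = 0) (hb : d b = 0)
    (M : Matrix (Fin n) (Fin n) ℍ[S,a,b]) (σ : Equiv.Perm (Fin n)) (x : Fin n) :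
    (quatDeriv d (cycleProd M σ x)).re = ∑ j, if σ.SameCycle x j then
      (cyclePrefix M σ j * quatDeriv d (M (σ⁻¹ j) j)).re else 0 := by
  set p := Function.minimalPeriod σ x with hp
  have hp0 : 0 < p := Equiv.Perm.minimalPeriod_pos σ x
  have hadd : ∀ k : ℕ, (σ ^ (p + k)) x = (σ ^ k) x := fun k => by
    rw [add_comm]; exact Equiv.Perm.pow_add_minimalPeriod σ x k
  have hterm : ∀ k < p,
      (((List.range k).map fun i => M ((σ ^ i) x) ((σ ^ (i + 1)) x)).prod *
        quatDeriv d (M ((σ ^ k) x) ((σ ^ (k + 1)) x)) *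
        ((List.range (p - 1 - k)).map fun i =>
          M ((σ ^ (k + 1 + i)) x) ((σ ^ (k + 1 + i + 1)) x)).prod).re =
      (cyclePrefix M σ ((σ ^ (k + 1)) x) *
        quatDeriv d (M (σ⁻¹ ((σ ^ (k + 1)) x)) ((σ ^ (k + 1)) x))).re := by
    intro k hk
    have h1 : Function.minimalPeriod σ ((σ ^ (k + 1)) x) - 1 = (p - 1 - k) + k := by
      rw [Equiv.Perm.SameCycle.minimalPeriod_eq
        (Equiv.Perm.sameCycle_pow_right.2 (Equiv.Perm.SameCycle.refl σ x))]
      omega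
    have h2 : σ⁻¹ ((σ ^ (k + 1)) x) = (σ ^ k) x := by
      rw [Equiv.Perm.inv_eq_iff_eq, Equiv.Perm.pow_succ_apply]
    have h3 : ∀ i : ℕ, (σ ^ i) ((σ ^ (k + 1)) x) = (σ ^ (k + 1 + i)) x := fun i => by
      rw [← Equiv.Perm.mul_apply, ← pow_add, add_comm]
    rw [QuaternionAlgebra.re_mul_comm, ← mul_assoc, h2, cyclePrefix, h1, List.range_add,
      List.map_append, List.prod_append, List.map_map]
    congr 4
    · simp only [h3, add_assoc]
    · refine List.map_congr_left fun i _ => ?_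
      have e1 : k + 1 + (p - 1 - k + i) = p + i := by omega
      have e2 : k + 1 + (p - 1 - k + i + 1) = p + (i + 1) := by omega
      simp only [Function.comp_apply, h3, e1, e2, hadd]
  rw [cycleProd, quatDeriv_prod_map_range ha hb, ← hp]
  rw [QuaternionAlgebra.re_sum, Finset.sum_congr rfl fun k hk => hterm k (Finset.mem_range.1 hk),
    ← Finset.sum_filter]
  refine Finset.sum_bij (fun k _ => (σ ^ (k + 1)) x) ?_ ?_ ?_ ?_
  · intro k _
    simp only [Finset.mem_filter, Finset.mem_univ, true_and]
    exact Equiv.Perm.sameCycle_pow_right.2 (Equiv.Perm.SameCycle.refl σ x)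
  · intro k hk m hm h
    rw [Equiv.Perm.pow_succ_apply, Equiv.Perm.pow_succ_apply] at h
    exact Equiv.Perm.pow_apply_inj_of_lt (Finset.mem_range.1 hk) (Finset.mem_range.1 hm)
      (σ.injective h)
  · intro j hj
    simp only [Finset.mem_filter, Finset.mem_univ, true_and] at hj
    -- The factor in column `j` has row `σ⁻¹ j`, so `k` is a time at which the orbit of `x` is
    -- there.
    obtain ⟨k, hk⟩ := Equiv.Perm.sameCycle_iff_exists_nat_pow.1
      (Equiv.Perm.sameCycle_symm_apply_right.2 hj)
    refine ⟨k % p, Finset.mem_range.2 (Nat.mod_lt _ hp0), ?_⟩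
    rw [Equiv.Perm.pow_succ_apply, ← Equiv.Perm.iterate_eq_pow,
      Function.iterate_mod_minimalPeriod_eq, Equiv.Perm.iterate_eq_pow, hk, Equiv.apply_symm_apply]
  · intro k _
    rfl

theorem derivation_prod_cycleMins {d : Derivation K S S} (ha : d a = 0) (hb : d b = 0)
    (M : Matrix (Fin n) (Fin n) ℍ[S,a,b]) (σ : Equiv.Perm (Fin n)) :
    d (∏ x ∈ cycleMins σ, (cycleProd M σ x).re) = ∑ j, cycleReProd M σ j *
      (cyclePrefix M σ j * quatDeriv d (M (σ⁻¹ j) j)).re := by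
  rw [derivation_prod]
  simp only [← re_quatDeriv, re_quatDeriv_cycleProd ha hb, Finset.mul_sum]
  rw [Finset.sum_comm]
  refine Finset.sum_congr rfl fun j _ => ?_
  obtain ⟨x, hx, hxj⟩ := exists_mem_cycleMins σ j
  rw [Finset.sum_eq_single_of_mem x hx, if_pos hxj, cycleReProd_eq_prod_erase M hx hxj]
  intro y hy hyx
  rw [if_neg, mul_zero]
  exact fun h => hyx (eq_of_mem_cycleMins hy hx (h.trans hxj.symm))

/-- For fixed `j`, the terms in which the entry of column `j` is differentiated add up to the real
part of `cdet j` with that column differentiated. -/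
theorem derivation_mooreDet [IsDomain S] [CharZero S] {d : Derivation K S S} (ha : d a = 0)
    (hb : d b = 0) {M : Matrix (Fin n) (Fin n) ℍ[S,a,b]} (hM : Mᴴ = M) :
    d (mooreDet M) = (cdetAdjugate M * M.map (quatDeriv d)).trace.re := by
  have h1 : (cdetAdjugate M * M.map (quatDeriv d)).trace =
      ∑ j, cdet j (M.updateCol j fun k => quatDeriv d (M k j)) := by
    simp only [cdet_updateCol, Matrix.trace, Matrix.diag_apply, Matrix.mul_apply, Matrix.map_apply]
  rw [h1, QuaternionAlgebra.re_sum, mooreDet, map_sum]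
  simp only [cdet_updateCol_eq_sum hM, QuaternionAlgebra.re_sum, map_zsmul,
    derivation_prod_cycleMins ha hb, QuaternionAlgebra.re_smul, Finset.smul_sum, smul_eq_mul]
  exact Finset.sum_comm

end Derivation

/-! ### Logarithmic derivatives. -/

section LogDeriv

variable {S : Type*} [CommRing S] {a b : S} {n : ℕ}

theorem re_trace_mul_comm (M N : Matrix (Fin n) (Fin n) ℍ[S,a,b]) :
    (M * N).trace.re = (N * M).trace.re := by
  simp only [Matrix.trace, Matrix.diag_apply, Matrix.mul_apply, QuaternionAlgebra.re_sum]
  rw [Finset.sum_comm]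
  simp only [QuaternionAlgebra.re_mul_comm]

theorem re_trace_conjTranspose (M : Matrix (Fin n) (Fin n) ℍ[S,a,b]) :
    Mᴴ.trace.re = M.trace.re := by
  simp [Matrix.trace, QuaternionAlgebra.re_sum]

theorem re_trace_smul (r : S) (M : Matrix (Fin n) (Fin n) ℍ[S,a,b]) :
    (r • M).trace.re = r * M.trace.re := by
  rw [Matrix.trace_smul, QuaternionAlgebra.re_smul, smul_eq_mul]

theorem conjTranspose_smul_coe (r : S) (M : Matrix (Fin n) (Fin n) ℍ[S,a,b]) :
    (r • M)ᴴ = r • Mᴴ := by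
  ext1 i j
  simp

variable {K : Type*} [CommRing K] [Algebra K S]

theorem map_quatDeriv_mul {d : Derivation K S S} (ha : d a = 0) (hb : d b = 0)
    (M N : Matrix (Fin n) (Fin n) ℍ[S,a,b]) :
    (M * N).map (quatDeriv d) = M.map (quatDeriv d) * N + M * N.map (quatDeriv d) := by
  ext1 i j
  simp only [Matrix.map_apply, Matrix.mul_apply, Matrix.add_apply, map_sum,
    quatDeriv_mul ha hb, Finset.sum_add_distrib]

theorem map_quatDeriv_conjTranspose (d : Derivation K S S) (M : Matrix (Fin n) (Fin n) ℍ[S,a,b]) :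
    Mᴴ.map (quatDeriv d) = (M.map (quatDeriv d))ᴴ := by
  ext1 i j
  simp [quatDeriv_star]

variable [IsDomain S] [CharZero S]

theorem mul_conjTranspose_cdetAdjugate {M : Matrix (Fin n) (Fin n) ℍ[S,a,b]} (hM : Mᴴ = M) :
    M * (cdetAdjugate M)ᴴ = mooreDet M • (1 : Matrix (Fin n) (Fin n) ℍ[S,a,b]) := by
  have := congrArg Matrix.conjTranspose (cdetAdjugate_mul hM)
  rwa [Matrix.conjTranspose_mul, hM, conjTranspose_smul_coe, Matrix.conjTranspose_one] at this

/-- A left and a right inverse up to the same nonzero scalar coincide. -/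
theorem conjTranspose_cdetAdjugate {M : Matrix (Fin n) (Fin n) ℍ[S,a,b]} (hM : Mᴴ = M)
    (h0 : mooreDet M ≠ 0) : (cdetAdjugate M)ᴴ = cdetAdjugate M := by
  have h : cdetAdjugate M * M * (cdetAdjugate M)ᴴ = cdetAdjugate M * (M * (cdetAdjugate M)ᴴ) :=
    mul_assoc _ _ _
  rw [cdetAdjugate_mul hM, mul_conjTranspose_cdetAdjugate hM, smul_mul_assoc, one_mul,
    mul_smul_comm, mul_one] at h
  exact smul_right_injective _ h0 h

/-- `X` stands for the determinant times `B⁻¹`. The two summands of the derivative that come from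
`Bᴴ` and from `B` have equal real traces, whence the factor two. -/
theorem derivation_mooreDet_conj {d : Derivation K S S} (ha : d a = 0) (hb : d b = 0)
    {M B : Matrix (Fin n) (Fin n) ℍ[S,a,b]} (hM : Mᴴ = M) (hdM : M.map (quatDeriv d) = 0) :
    ∃ X : Matrix (Fin n) (Fin n) ℍ[S,a,b],
      X * B = mooreDet (Bᴴ * M * B) • (1 : Matrix (Fin n) (Fin n) ℍ[S,a,b]) ∧
      d (mooreDet (Bᴴ * M * B)) = 2 * (X * B.map (quatDeriv d)).trace.re := by
  set G := Bᴴ * M * B with hG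
  have hGh : Gᴴ = G := by
    rw [hG, Matrix.conjTranspose_mul, Matrix.conjTranspose_mul, hM,
      Matrix.conjTranspose_conjTranspose, mul_assoc]
  -- If the determinant vanishes, `X = 0` serves; otherwise the adjugate is Hermitian.
  by_cases h0 : mooreDet G = 0
  · exact ⟨0, by rw [h0, zero_mul, zero_smul], by rw [h0]; simp⟩
  refine ⟨cdetAdjugate G * (Bᴴ * M), by rw [mul_assoc, ← hG, cdetAdjugate_mul hGh], ?_⟩
  have hdG : G.map (quatDeriv d) =
      (B.map (quatDeriv d))ᴴ * M * B + Bᴴ * M * B.map (quatDeriv d) := by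
    rw [hG, map_quatDeriv_mul ha hb, map_quatDeriv_mul ha hb, hdM, mul_zero, add_zero,
      map_quatDeriv_conjTranspose]
  have hsymm : (cdetAdjugate G * ((B.map (quatDeriv d))ᴴ * M * B)).trace.re =
      (cdetAdjugate G * (Bᴴ * M * B.map (quatDeriv d))).trace.re := by
    rw [← re_trace_conjTranspose, Matrix.conjTranspose_mul, Matrix.conjTranspose_mul,
      Matrix.conjTranspose_mul, hM, Matrix.conjTranspose_conjTranspose,
      conjTranspose_cdetAdjugate hGh h0, re_trace_mul_comm, mul_assoc Bᴴ]
  rw [derivation_mooreDet ha hb hGh, hdG, mul_add, Matrix.trace_add, QuaternionAlgebra.re_add,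
    hsymm, two_mul, mul_assoc (cdetAdjugate G)]

/-- The logarithmic derivatives of the Moore determinants of `Bᴴ * M * B` and `B * Bᴴ` agree if
`M` is constant. -/
theorem derivation_mooreDet_conj_mul {d : Derivation K S S} (ha : d a = 0) (hb : d b = 0)
    {M B : Matrix (Fin n) (Fin n) ℍ[S,a,b]} (hM : Mᴴ = M) (hdM : M.map (quatDeriv d) = 0) :
    d (mooreDet (Bᴴ * M * B)) * mooreDet (B * Bᴴ) =
      mooreDet (Bᴴ * M * B) * d (mooreDet (B * Bᴴ)) := by
  obtain ⟨X, hX, hdX⟩ := derivation_mooreDet_conj ha hb (B := B) hM hdM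
  have h1 : (1 : Matrix (Fin n) (Fin n) ℍ[S,a,b]).map (quatDeriv d) = 0 := by
    ext1 i j
    by_cases h : i = j
    · simp [h, quatDeriv_one]
    · simp [h]
  obtain ⟨Z, hZ, hdZ⟩ := derivation_mooreDet_conj ha hb (B := Bᴴ) (Matrix.conjTranspose_one) h1
  rw [mul_one, Matrix.conjTranspose_conjTranspose] at hZ hdZ
  have hZ' : B * Zᴴ = mooreDet (B * Bᴴ) • (1 : Matrix (Fin n) (Fin n) ℍ[S,a,b]) := by
    have := congrArg Matrix.conjTranspose hZ
    rwa [Matrix.conjTranspose_mul, Matrix.conjTranspose_conjTranspose, conjTranspose_smul_coe,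
      Matrix.conjTranspose_one] at this
  -- `X` is a left and `Zᴴ` a right inverse of `B` up to scalars; evaluating `X * B * Zᴴ` in two
  -- ways compares them.
  have hXZ : mooreDet (B * Bᴴ) • X = mooreDet (Bᴴ * M * B) • Zᴴ := by
    have h : X * B * Zᴴ = X * (B * Zᴴ) := mul_assoc _ _ _
    rw [hX, hZ', smul_mul_assoc, one_mul, mul_smul_comm, mul_one] at h
    exact h.symm
  have hdZ' : d (mooreDet (B * Bᴴ)) = 2 * (Zᴴ * B.map (quatDeriv d)).trace.re := by
    rw [hdZ, map_quatDeriv_conjTranspose, ← re_trace_conjTranspose, Matrix.conjTranspose_mul,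
      Matrix.conjTranspose_conjTranspose, re_trace_mul_comm]
  have h := congrArg (fun Y => (Y * B.map (quatDeriv d)).trace.re) hXZ
  simp only [smul_mul_assoc, re_trace_smul] at h
  rw [hdX, hdZ', mul_assoc, mul_comm _ (mooreDet (B * Bᴴ)), h]
  ring

end LogDeriv

/-! ### Change of the base ring. -/

section Functoriality

variable {S T : Type*} [CommRing S] [CommRing T] {a b : S} {a' b' : T} {n : ℕ}

/-- The homomorphism of quaternion algebras induced by a homomorphism of the base rings. -/
def quatMap (f : S →+* T) (ha : f a = a') (hb : f b = b') : ℍ[S,a,b] →+* ℍ[T,a',b'] where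
  toFun x := ⟨f x.re, f x.imI, f x.imJ, f x.imK⟩
  map_zero' := by ext <;> simp
  map_one' := by ext <;> simp
  map_add' x y := by ext <;> simp
  map_mul' x y := by ext <;> simp [ha, hb]

variable (f : S →+* T) (ha : f a = a') (hb : f b = b')

theorem re_quatMap (x : ℍ[S,a,b]) : (quatMap f ha hb x).re = f x.re := rfl

theorem quatMap_star (x : ℍ[S,a,b]) : quatMap f ha hb (star x) = star (quatMap f ha hb x) := by
  ext <;> simp [quatMap]

theorem quatMap_coe (r : S) : quatMap f ha hb (r : ℍ[S,a,b]) = ((f r : T) : ℍ[T,a',b']) := by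
  ext <;> simp [quatMap]

theorem map_quatMap_conjTranspose (M : Matrix (Fin n) (Fin n) ℍ[S,a,b]) :
    Mᴴ.map (quatMap f ha hb) = (M.map (quatMap f ha hb))ᴴ := by
  ext1 i j
  simp [quatMap_star]

theorem map_quatMap_smul (r : S) (M : Matrix (Fin n) (Fin n) ℍ[S,a,b]) :
    (r • M).map (quatMap f ha hb) = f r • M.map (quatMap f ha hb) := by
  ext1 i j
  simp only [Matrix.map_apply, Matrix.smul_apply, ← QuaternionAlgebra.coe_mul_eq_smul, map_mul,
    quatMap_coe]

theorem map_mooreDet (M : Matrix (Fin n) (Fin n) ℍ[S,a,b]) :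
    f (mooreDet M) = mooreDet (M.map (quatMap f ha hb)) := by
  simp only [mooreDet, map_sum, map_zsmul, map_prod, ← re_quatMap f ha hb, map_cycleProd]

theorem map_cdet {A B : Type*} [Ring A] [Ring B] (g : A →+* B) (j : Fin n)
    (M : Matrix (Fin n) (Fin n) A) : g (cdet j M) = cdet j (M.map g) := by
  simp only [cdet, map_sum, map_zsmul, map_mul, map_list_prod, List.map_map, Function.comp_def,
    map_cycleProd]

theorem map_cdetAdjugate {A B : Type*} [Ring A] [Ring B] (g : A →+* B)
    (M : Matrix (Fin n) (Fin n) A) : (cdetAdjugate M).map g = cdetAdjugate (M.map g) := by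
  ext1 j k
  simp only [cdetAdjugate, Matrix.map_apply, Matrix.of_apply, map_cdet, Matrix.map_updateCol]
  congr 2
  ext i
  by_cases h : i = k
  · subst h; simp
  · simp [h]

theorem mooreDet_one : mooreDet (1 : Matrix (Fin n) (Fin n) ℍ[S,a,b]) = 1 := by
  rw [mooreDet, Finset.sum_eq_single 1]
  · have : ∀ x : Fin n, cycleProd (1 : Matrix (Fin n) (Fin n) ℍ[S,a,b]) 1 x = 1 := fun x => by
      refine List.prod_eq_one fun y hy => ?_
      obtain ⟨k, -, rfl⟩ := List.mem_map.1 hy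
      rw [one_pow, one_pow]
      exact Matrix.one_apply_eq x
    simp [this]
  · intro σ _ hσ
    obtain ⟨j, hj⟩ : ∃ j, σ j ≠ j := by
      by_contra! h
      exact hσ (Equiv.ext h)
    obtain ⟨u, hu, -⟩ := cycleProd_apply_eq (1 : Matrix (Fin n) (Fin n) ℍ[S,a,b]) σ j
    rw [← cycleReProd_mul_re _ σ j, hu, Matrix.one_apply_ne (Ne.symm hj), zero_mul,
      QuaternionAlgebra.re_zero, mul_zero, smul_zero]
  · simp

end Functoriality

/-! ### Multiplicativity along a segment. -/

section Multiplicativity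

open Polynomial

variable {R : Type*} [CommRing R] [IsDomain R] [CharZero R]

/-- A polynomial with the same logarithmic derivative as `k` is a constant multiple of `k`. -/
theorem Polynomial.eq_C_mul_of_derivative_mul_eq {g k : R[X]} (hk : k.eval 0 = 1)
    (h : derivative g * k = g * derivative k) : g = C (g.eval 0) * k := by
  -- `u` satisfies the same equation as `g` and vanishes at `0`. If `u = X ^ (m + 1) * v` with `v(0)
  -- ≠ 0`, the lowest coefficient of the equation gives `(m + 1) * v(0) = 0`, impossible in
  -- characteristic zero.
  set u := g - C (g.eval 0) * k with hu
  have hu0 : u.eval 0 = 0 := by simp [hu, hk]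
  have hud : derivative u * k = u * derivative k := by
    simp only [hu, derivative_sub, derivative_C_mul, sub_mul, h]
    ring
  by_contra hne
  have hune : u ≠ 0 := fun h' => hne (sub_eq_zero.1 h')
  obtain ⟨v, hv, hdvd⟩ := exists_eq_pow_rootMultiplicity_mul_and_not_dvd u hune 0
  have hm : 0 < rootMultiplicity 0 u := (rootMultiplicity_pos hune).2 hu0
  obtain ⟨m, hm'⟩ := Nat.exists_eq_succ_of_ne_zero hm.ne'
  rw [hm', C_0, sub_zero] at hv
  rw [dvd_iff_isRoot, IsRoot.def] at hdvd
  have h1 : X ^ m * (((m + 1 : ℕ) : R[X]) * v * k +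
      X * (derivative v * k - v * derivative k)) = 0 := by
    rw [hv] at hud
    simp only [derivative_mul, derivative_X_pow, Nat.succ_eq_add_one, Nat.add_sub_cancel] at hud
    rw [map_natCast] at hud
    linear_combination hud
  have h2 := (mul_eq_zero.1 h1).resolve_left (pow_ne_zero _ X_ne_zero)
  have h3 := congrArg (eval 0) h2
  simp only [eval_add, eval_mul, eval_natCast, eval_X, hk, zero_mul, add_zero, eval_zero,
    mul_one] at h3
  rcases mul_eq_zero.1 h3 with h4 | h4
  · exact Nat.cast_ne_zero.2 (Nat.succ_ne_zero m) h4
  · exact hdvd h4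

variable {a b : R} {n : ℕ}

/-- On the segment `B' = 1 + X • (B - 1)` over `R[X]` both determinants have the same logarithmic
derivative. At `X = 0` they are `mooreDet M` and `1`; at `X = 1` they are the two in question. -/
theorem mooreDet_conj {M : Matrix (Fin n) (Fin n) ℍ[R,a,b]} (hM : Mᴴ = M)
    (B : Matrix (Fin n) (Fin n) ℍ[R,a,b]) :
    mooreDet (Bᴴ * M * B) = mooreDet M * mooreDet (B * Bᴴ) := by
  let c : ℍ[R,a,b] →+* ℍ[R[X],C a,C b] := quatMap C rfl rfl
  let e (r : R) : ℍ[R[X],C a,C b] →+* ℍ[R,a,b] := quatMap (evalRingHom r) (by simp) (by simp)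
  let d : Derivation R R[X] R[X] := derivative'
  have hd : ∀ r : R, d (C r) = 0 := fun r => derivative_C
  let B' : Matrix (Fin n) (Fin n) ℍ[R[X],C a,C b] := 1 + (X : R[X]) • (B - 1).map c
  let M' : Matrix (Fin n) (Fin n) ℍ[R[X],C a,C b] := M.map c
  have hM' : M'ᴴ = M' := by
    rw [← map_quatMap_conjTranspose, hM]
  have hdM' : M'.map (quatDeriv d) = 0 := by
    ext1 i j
    exact QuaternionAlgebra.ext (hd _) (hd _) (hd _) (hd _)
  have hec : ∀ r x, e r (c x) = x := fun r x => by
    ext <;> simp [e, c, quatMap]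
  have heM : ∀ r, M'.map (e r) = M := fun r => by
    ext1 i j
    simp [M', hec]
  have heB : ∀ r, B'.map (e r) = 1 + r • (B - 1) := fun r => by
    have h1 : ((1 : Matrix (Fin n) (Fin n) ℍ[R[X],C a,C b])).map (e r) = 1 :=
      Matrix.map_one _ (map_zero _) (map_one _)
    have h2 : ((B - 1).map c).map (e r) = B - 1 := by
      ext1 i j
      simp [hec]
    rw [Matrix.map_add _ (map_add _), h1, map_quatMap_smul, h2]
    simp
  have hconj : ∀ r, eval r (mooreDet (B'ᴴ * M' * B')) =
      mooreDet ((1 + r • (B - 1))ᴴ * M * (1 + r • (B - 1))) := fun r => by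
    rw [← heB r]
    conv_rhs => rw [← heM r]
    rw [← coe_evalRingHom, map_mooreDet (evalRingHom r) (a' := a) (b' := b) (by simp) (by simp),
      Matrix.map_mul, Matrix.map_mul, map_quatMap_conjTranspose]
  have hself : ∀ r, eval r (mooreDet (B' * B'ᴴ)) =
      mooreDet ((1 + r • (B - 1)) * (1 + r • (B - 1))ᴴ) := fun r => by
    rw [← heB r]
    rw [← coe_evalRingHom, map_mooreDet (evalRingHom r) (a' := a) (b' := b) (by simp) (by simp),
      Matrix.map_mul, map_quatMap_conjTranspose]
  have hk : eval 0 (mooreDet (B' * B'ᴴ)) = 1 := by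
    rw [hself]
    simp [mooreDet_one]
  have hlog := derivation_mooreDet_conj_mul (hd a) (hd b) (B := B') hM' hdM'
  have h := congrArg (eval 1) (Polynomial.eq_C_mul_of_derivative_mul_eq hk hlog)
  rw [eval_mul, eval_C, hconj, hconj, hself] at h
  simpa using h

theorem mooreDet_conjTranspose_mul_self (B : Matrix (Fin n) (Fin n) ℍ[R,a,b]) :
    mooreDet (Bᴴ * B) = mooreDet (B * Bᴴ) := by
  have := mooreDet_conj (M := 1) Matrix.conjTranspose_one B
  rwa [mul_one, mooreDet_one, one_mul] at this

end Multiplicativity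

/-! ### Specialization to arbitrary base rings. -/

section Universal

variable {F : Type*} [CommRing F] {a b : F} {n : ℕ}

/-- The evaluation of the polynomials over `ℤ` whose indeterminates are the elements of `F`. -/
noncomputable def universalEval (F : Type*) [CommRing F] : MvPolynomial F ℤ →+* F :=
  (MvPolynomial.aeval (id : F → F)).toRingHom

theorem universalEval_X (r : F) : universalEval F (MvPolynomial.X r) = r := by
  simp [universalEval]

variable (a b) in
/-- The homomorphism from the quaternion algebra with generic parameters. -/
noncomputable def universalQuatMap :
    ℍ[MvPolynomial F ℤ,MvPolynomial.X a,MvPolynomial.X b] →+* ℍ[F,a,b] :=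
  quatMap (universalEval F) (universalEval_X a) (universalEval_X b)

/-- Every coordinate lifts to its own indeterminate, over a domain of characteristic zero. `AᴴA`
then lifts to a Hermitian matrix, whereas in characteristic two a general Hermitian matrix need not,
its diagonal being unrestricted. -/
theorem exists_map_universalQuatMap_eq (A : Matrix (Fin n) (Fin n) ℍ[F,a,b]) :
    ∃ A' : Matrix (Fin n) (Fin n) ℍ[MvPolynomial F ℤ,MvPolynomial.X a,MvPolynomial.X b],
      A'.map (universalQuatMap a b) = A := by
  refine ⟨Matrix.of fun i j => ⟨.X (A i j).re, .X (A i j).imI, .X (A i j).imJ, .X (A i j).imK⟩, ?_⟩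
  ext1 i j
  exact QuaternionAlgebra.ext (universalEval_X _) (universalEval_X _) (universalEval_X _)
    (universalEval_X _)

theorem map_universalQuatMap_conjTranspose
    (M : Matrix (Fin n) (Fin n) ℍ[MvPolynomial F ℤ,MvPolynomial.X a,MvPolynomial.X b]) :
    (M.map (universalQuatMap a b))ᴴ = Mᴴ.map (universalQuatMap a b) :=
  (map_quatMap_conjTranspose ..).symm

theorem mooreDet_map_universalQuatMap
    (M : Matrix (Fin n) (Fin n) ℍ[MvPolynomial F ℤ,MvPolynomial.X a,MvPolynomial.X b]) :
    mooreDet (M.map (universalQuatMap a b)) = universalEval F (mooreDet M) :=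
  (map_mooreDet ..).symm

theorem cdet_conjTranspose_mul_self (A : Matrix (Fin n) (Fin n) ℍ[F,a,b]) (j : Fin n) :
    cdet j (Aᴴ * A) = ((mooreDet (Aᴴ * A) : F) : ℍ[F,a,b]) := by
  obtain ⟨A, rfl⟩ := exists_map_universalQuatMap_eq A
  rw [map_universalQuatMap_conjTranspose, ← Matrix.map_mul, ← map_cdet,
    cdet_eq_mooreDet (Matrix.isHermitian_conjTranspose_mul_self A), mooreDet_map_universalQuatMap]
  exact quatMap_coe _ _ _ _

theorem rdet_conjTranspose_mul_self (A : Matrix (Fin n) (Fin n) ℍ[F,a,b]) (j : Fin n) :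
    rdet j (Aᴴ * A) = ((mooreDet (Aᴴ * A) : F) : ℍ[F,a,b]) := by
  rw [rdet_eq_star_cdet, (Matrix.isHermitian_conjTranspose_mul_self A).eq,
    cdet_conjTranspose_mul_self, QuaternionAlgebra.star_coe]

theorem cdetAdjugate_mul_conjTranspose_mul_self (A : Matrix (Fin n) (Fin n) ℍ[F,a,b]) :
    cdetAdjugate (Aᴴ * A) * (Aᴴ * A) =
      mooreDet (Aᴴ * A) • (1 : Matrix (Fin n) (Fin n) ℍ[F,a,b]) := by
  obtain ⟨A, rfl⟩ := exists_map_universalQuatMap_eq A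
  rw [map_universalQuatMap_conjTranspose, ← Matrix.map_mul, ← map_cdetAdjugate, ← Matrix.map_mul,
    cdetAdjugate_mul (Matrix.isHermitian_conjTranspose_mul_self A), mooreDet_map_universalQuatMap]
  refine (map_quatMap_smul _ _ _ _ _).trans ?_
  rw [Matrix.map_one _ (map_zero _) (map_one _)]

theorem mooreDet_self_mul_conjTranspose (A : Matrix (Fin n) (Fin n) ℍ[F,a,b]) :
    mooreDet (A * Aᴴ) = mooreDet (Aᴴ * A) := by
  obtain ⟨A, rfl⟩ := exists_map_universalQuatMap_eq A
  rw [map_universalQuatMap_conjTranspose, ← Matrix.map_mul, ← Matrix.map_mul,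
    mooreDet_map_universalQuatMap, mooreDet_map_universalQuatMap, mooreDet_conjTranspose_mul_self]

theorem mooreDet_conjTranspose_mul_mul (A B : Matrix (Fin n) (Fin n) ℍ[F,a,b]) :
    mooreDet ((A * B)ᴴ * (A * B)) = mooreDet (Aᴴ * A) * mooreDet (Bᴴ * B) := by
  obtain ⟨A, rfl⟩ := exists_map_universalQuatMap_eq A
  obtain ⟨B, rfl⟩ := exists_map_universalQuatMap_eq B
  simp only [← Matrix.map_mul, map_universalQuatMap_conjTranspose, mooreDet_map_universalQuatMap]
  rw [← map_mul, mooreDet_conjTranspose_mul_self B,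
    ← mooreDet_conj (Matrix.isHermitian_conjTranspose_mul_self A), Matrix.conjTranspose_mul]
  simp only [mul_assoc]

end Universal

/-! ### Invertibility and Cramer's rule. -/

section Inverse

variable {F : Type*} [Field F] {a b : F} {n : ℕ}

theorem ddet_eq_mooreDet [NeZero n] (A : Matrix (Fin n) (Fin n) ℍ[F,a,b]) :
    ddet A = mooreDet (Aᴴ * A) := by
  rw [ddet, hermDet, rdet_conjTranspose_mul_self, QuaternionAlgebra.re_coe]

theorem ddet_conjTranspose [NeZero n] (A : Matrix (Fin n) (Fin n) ℍ[F,a,b]) :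
    ddet Aᴴ = ddet A := by
  rw [ddet_eq_mooreDet, ddet_eq_mooreDet, Matrix.conjTranspose_conjTranspose,
    mooreDet_self_mul_conjTranspose]

theorem ddet_mul [NeZero n] (A B : Matrix (Fin n) (Fin n) ℍ[F,a,b]) :
    ddet (A * B) = ddet A * ddet B := by
  simp only [ddet_eq_mooreDet, mooreDet_conjTranspose_mul_mul]

theorem ddet_one [NeZero n] : ddet (1 : Matrix (Fin n) (Fin n) ℍ[F,a,b]) = 1 := by
  rw [ddet_eq_mooreDet, Matrix.conjTranspose_one, one_mul, mooreDet_one]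

theorem ddet_ne_zero_of_isUnit [NeZero n] {A : Matrix (Fin n) (Fin n) ℍ[F,a,b]} (h : IsUnit A) :
    ddet A ≠ 0 := by
  obtain ⟨B, hB⟩ := h.exists_right_inv
  intro h0
  have := ddet_mul A B
  rw [hB, ddet_one, h0, zero_mul] at this
  exact one_ne_zero this

theorem smul_cdetAdjugate_mul_mul [NeZero n] {A : Matrix (Fin n) (Fin n) ℍ[F,a,b]}
    (h : ddet A ≠ 0) : ((ddet A)⁻¹ • cdetAdjugate (Aᴴ * A)) * (Aᴴ * A) = 1 := by
  rw [smul_mul_assoc, cdetAdjugate_mul_conjTranspose_mul_self, ← ddet_eq_mooreDet, smul_smul,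
    inv_mul_cancel₀ h, one_smul]

/-- The adjugate of `AᴴA` provides a left inverse of `A`. A right inverse is the conjugate transpose
of the left inverse of `Aᴴ`, which exists because `ddet Aᴴ = ddet A`. -/
theorem isUnit_of_ddet_ne_zero [NeZero n] {A : Matrix (Fin n) (Fin n) ℍ[F,a,b]}
    (h : ddet A ≠ 0) : IsUnit A := by
  rw [isUnit_iff_exists_and_exists]
  refine ⟨?_, _, (mul_assoc _ _ _).trans (smul_cdetAdjugate_mul_mul h)⟩
  have h' := congrArg Matrix.conjTranspose
    (smul_cdetAdjugate_mul_mul (A := Aᴴ) (by rwa [ddet_conjTranspose]))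
  rw [Matrix.conjTranspose_mul, Matrix.conjTranspose_mul, Matrix.conjTranspose_one,
    Matrix.conjTranspose_conjTranspose, mul_assoc] at h'
  exact ⟨_, h'⟩

theorem isUnit_iff_ddet_ne_zero [NeZero n] (A : Matrix (Fin n) (Fin n) ℍ[F,a,b]) :
    IsUnit A ↔ ddet A ≠ 0 :=
  ⟨ddet_ne_zero_of_isUnit, isUnit_of_ddet_ne_zero⟩

theorem leftInv_mul_self {A : Matrix (Fin n) (Fin n) ℍ[F,a,b]} (h : IsUnit (Aᴴ * A)) :
    leftInv A * A = 1 := by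
  rw [leftInv, mul_assoc, Ring.inverse_mul_cancel _ h]

theorem self_mul_rightInv {A : Matrix (Fin n) (Fin n) ℍ[F,a,b]} (h : IsUnit (A * Aᴴ)) :
    A * rightInv A = 1 := by
  rw [rightInv, ← mul_assoc, Ring.mul_inverse_cancel _ h]

theorem leftInv_eq_smul_leftDoubleCofactor [NeZero n] {A : Matrix (Fin n) (Fin n) ℍ[F,a,b]}
    (h : ddet A ≠ 0) (hu : IsUnit (Aᴴ * A)) :
    leftInv A = (ddet A)⁻¹ • Matrix.of (fun i j => leftDoubleCofactor A j i) := by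
  have h1 : Ring.inverse (Aᴴ * A) = (ddet A)⁻¹ • cdetAdjugate (Aᴴ * A) :=
    (left_inv_eq_right_inv (smul_cdetAdjugate_mul_mul h) (Ring.mul_inverse_cancel _ hu)).symm
  rw [leftInv, h1, smul_mul_assoc]
  congr 1
  ext1 i j
  rw [Matrix.of_apply, leftDoubleCofactor, cdet_updateCol, Matrix.mul_apply]

theorem rightDoubleCofactor_eq_star (A : Matrix (Fin n) (Fin n) ℍ[F,a,b]) (i j : Fin n) :
    rightDoubleCofactor A i j = star (leftDoubleCofactor Aᴴ j i) := by
  rw [rightDoubleCofactor, leftDoubleCofactor, star_cdet, Matrix.conjTranspose_conjTranspose,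
    ← Matrix.updateRow_conjTranspose, (Matrix.isHermitian_mul_conjTranspose_self A).eq]
  rfl

end Inverse

theorem mainTheorem2 {F : Type*} [Field F] (a b : F) {n : ℕ} [NeZero n]
    (A : Matrix (Fin n) (Fin n) ℍ[F,a,b]) :
    -- `ddet A` is the common value in `F` of all row and column determinants of `A* A` and `A A*`
    (∀ i, rdet i (Aᴴ * A) = ((ddet A : F) : ℍ[F,a,b]) ∧
      cdet i (Aᴴ * A) = ((ddet A : F) : ℍ[F,a,b]) ∧
      rdet i (A * Aᴴ) = ((ddet A : F) : ℍ[F,a,b]) ∧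
      cdet i (A * Aᴴ) = ((ddet A : F) : ℍ[F,a,b])) ∧
    (IsUnit A ↔ ddet A ≠ 0) ∧
    (ddet A ≠ 0 →
      IsUnit (Aᴴ * A) ∧ IsUnit (A * Aᴴ) ∧
      leftInv A * A = 1 ∧ A * rightInv A = 1 ∧
      Ring.inverse A = leftInv A ∧ leftInv A = rightInv A ∧
      leftInv A = (ddet A)⁻¹ • Matrix.of (fun i j => leftDoubleCofactor A j i) ∧
      rightInv A = (ddet Aᴴ)⁻¹ • Matrix.of (fun i j => rightDoubleCofactor A j i)) := by
  refine ⟨fun i => ?_, isUnit_iff_ddet_ne_zero A, fun h => ?_⟩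
  · have h1 := rdet_conjTranspose_mul_self Aᴴ i
    have h2 := cdet_conjTranspose_mul_self Aᴴ i
    rw [← ddet_eq_mooreDet, Matrix.conjTranspose_conjTranspose, ddet_conjTranspose] at h1 h2
    rw [h1, h2, rdet_conjTranspose_mul_self, cdet_conjTranspose_mul_self, ← ddet_eq_mooreDet]
    exact ⟨rfl, rfl, rfl, rfl⟩
  · have hA : IsUnit A := isUnit_of_ddet_ne_zero h
    have h' : ddet Aᴴ ≠ 0 := by rwa [ddet_conjTranspose]
    have hA' : IsUnit Aᴴ := isUnit_of_ddet_ne_zero h'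
    have hL : leftInv A * A = 1 := leftInv_mul_self (hA'.mul hA)
    have hR : A * rightInv A = 1 := self_mul_rightInv (hA.mul hA')
    refine ⟨hA'.mul hA, hA.mul hA', hL, hR, ?_, left_inv_eq_right_inv hL hR,
      leftInv_eq_smul_leftDoubleCofactor h (hA'.mul hA), ?_⟩
    · exact (left_inv_eq_right_inv hL (Ring.mul_inverse_cancel _ hA)).symm
    · have hu : IsUnit (Aᴴᴴ * Aᴴ) := by
        rw [Matrix.conjTranspose_conjTranspose]
        exact hA.mul hA'
      -- A second right inverse of `A`, hence equal to `rightInv A`; it carries the formula for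
      -- `leftInv Aᴴ` over to `rightInv A`.
      have h1 : A * (leftInv Aᴴ)ᴴ = 1 := by
        have := congrArg Matrix.conjTranspose (leftInv_mul_self hu)
        rwa [Matrix.conjTranspose_mul, Matrix.conjTranspose_conjTranspose,
          Matrix.conjTranspose_one] at this
      rw [← left_inv_eq_right_inv hL hR, left_inv_eq_right_inv hL h1,
        leftInv_eq_smul_leftDoubleCofactor h' hu, conjTranspose_smul_coe]
      congr 1
      ext1 i j
      rw [Matrix.conjTranspose_apply, Matrix.of_apply, Matrix.of_apply,
        rightDoubleCofactor_eq_star]
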